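/- Let $G\subset \mathrm{GL}(n,\mathbb R)$ be a real linear algebraic group (the zero set in $\mathrm{GL}(n,\mathbb R)$ of polynomials in the matrix entries), stable under transposition, acting by matrices on a real affine algebraic variety $M\subset\mathbb R^n$ (e.g. a smooth one). Let $r^2(m)=m_1^2+\dots+m_n^2$, and let $K\subset G$ be a maximal compact subgroup that leaves $r^2$ invariant. Let $\mathfrak g=\{X\in M_n(\mathbb R): e^{tX}\in G \text{ for all } t\in\mathbb R\}$ be the Lie algebra of $G$, $\mathfrak U(\mathfrak g_{\mathbb C})$ the universal enveloping algebra of its complexification, and $(\pi(g)\varphi)(m)=\varphi(g^{-1}m)$ the left regular representation of $G$ on the Banach space $C_0(M)$ of continuous complex functions on $M$ vanishing at infinity, with sup norm. For $X\in\mathfrak g$ put $d\pi(X)\varphi=\frac{d}{dt}\pi(e^{tX})\varphi|_{t=0}$ whenever this norm limit exists. Let $\mathbb C[M]$ be the algebra of restrictions to $M$ of complex polynomials on $\mathbb R^n$; for $X\in\mathfrak g$ and $q\in\mathbb C[M]$ put $(d\rho(X)q)(m)=\frac{d}{dt}q(e^{-tX}m)|_{t=0}$ and $d\pi'(X)q=d\rho(X)q-(d\rho(X)r^2)\,q$.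 For $q\in\mathbb C[M]$ let $$W_q=d\pi(\mathfrak U(\mathfrak g_{\mathbb C}))\,\mathrm{Span}\{\pi(k)(q\,e^{-r^2}):k\in K\}\subset C_0(M),$$ i.e. the smallest complex subspace that contains all $\pi(k)(q\,e^{-r^2})$, $k\in K$, and is invariant under all $d\pi(X)$, $X\in\mathfrak g$; let $\overline W_q$ be its closure. A \emph{Banach representation} is a representation by bounded operators on a Banach space with continuous orbit maps. A \emph{reducing series} for a Banach representation $\sigma$ of $G$ on $\mathcal B$ is a family $\mathfrak B$ of closed subspaces of $\mathcal B$, totally ordered by inclusion, each stable under all operators $\sigma(f)=\int_G f(g)\sigma(g)\,dg$ ($f\in C_c(G)$, $dg$ a left Haar measure), such that $\{0\},\mathcal B\in\mathfrak B$ and, for every subfamily $\mathfrak A\subset\mathfrak B$, $\bigcap_{A\in\mathfrak A}A$ and $\overline{\bigcup_{A\in\mathfrak A}A}$ lie in $\mathfrak B$ (for $\mathfrak A=\emptyset$ these are read as $\mathcal B$ and $\{0\}$). It is \emph{discrete} if, whenever $\mathcal B_1\subsetneq\mathcal B_2$ are in $\mathfrak B$, there are $\tilde{\mathcal B}_1\subsetneq\tilde{\mathcal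 B}_2$ in $\mathfrak B$ with $\mathcal B_1\subset\tilde{\mathcal B}_1$, $\tilde{\mathcal B}_2\subset\mathcal B_2$ and no member of $\mathfrak B$ strictly between $\tilde{\mathcal B}_1$ and $\tilde{\mathcal B}_2$. **Proposition.** Let $p\in\mathbb C[M]$, let $X_1,X_2,X_3,\dots$ be arbitrary elements of $\mathfrak g$, and put $\mathcal B_0=\overline W_p$, $\mathcal B_k=\overline W_{d\pi'(X_k)\cdots d\pi'(X_1)p}$ for $k\ge1$. Then $\mathcal B_0\supset\mathcal B_1\supset\mathcal B_2\supset\cdots$; the subspace $\overline W_p$ is $\pi(G)$-invariant and $(\pi,\overline W_p)$ is a Banach representation of $G$. For every $N\ge0$ the finite family $\{\mathcal B_0,\dots,\mathcal B_N\}\cup\{\{0\}\}$ is a discrete reducing series for $(\pi,\overline W_p)$, and so is the family $\{\mathcal B_0,\mathcal B_1,\mathcal B_2,\dots\}\cup\{\bigcap_{k}\mathcal B_k,\ \{0\}\}$. -/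

import Mathlib

open scoped ZeroAtInfty Matrix

noncomputable section

/-! ### Representations on a complex normed space and their reducing series -/

section Representations

variable {G : Type*} [Group G]
  {E : Type*} [NormedAddCommGroup E] [NormedSpace ℂ E]

/-- A representation of `G` by bounded operators is a Banach representation if the space is
complete and all orbit maps `g ↦ π(g) φ` are (norm) continuous. -/
def IsBanachRep [TopologicalSpace G] (π : G →* (E →L[ℂ] E)) : Prop :=
  CompleteSpace E ∧ ∀ φ : E, Continuous fun g => π g φ

/-- Restriction of a representation to an invariant subspace. -/
def restrictRep (π : G →* (E →L[ℂ] E)) (V : Submodule ℂ E) (hV : ∀ g, ∀ φ ∈ V, π g φ ∈ V) :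
    G →* (V →L[ℂ] V) where
  toFun g := (π g).restrict (hV g)
  map_one' := by ext v; simp
  map_mul' g h := by ext v; simp

/-- Stability of a subspace under the operators `π(f) φ = ∫ f(g) π(g) φ dν(g)`, `f ∈ C_c(G)`. -/
def IsCcStable [TopologicalSpace G] [MeasurableSpace G] (ν : MeasureTheory.Measure G)
    (π : G →* (E →L[ℂ] E)) (A : Submodule ℂ E) : Prop :=
  ∀ f : G → ℂ, Continuous f → HasCompactSupport f → ∀ φ ∈ A, ∫ g, f g • π g φ ∂ν ∈ A

/-- A reducing series for `π` on `E`: a nested family of closed `π(C_c(G))`-stable subspaces,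
containing `0` and `E`, and closed under arbitrary intersections and under closures of arbitrary
unions. (The union of a non-empty nested family of subspaces is its supremum; the union of the
empty family is read as `0`, the intersection of the empty family is `E`.) -/
structure IsReducingSeries [TopologicalSpace G] [MeasurableSpace G] (ν : MeasureTheory.Measure G)
    (π : G →* (E →L[ℂ] E)) (𝔅 : Set (Submodule ℂ E)) : Prop where
  nested : IsChain (· ≤ ·) 𝔅
  closed : ∀ A ∈ 𝔅, IsClosed (A : Set E)
  stable : ∀ A ∈ 𝔅, IsCcStable ν π A
  bot_mem : ⊥ ∈ 𝔅
  top_mem : ⊤ ∈ 𝔅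
  sInter_mem : ∀ 𝔄 ⊆ 𝔅, sInf 𝔄 ∈ 𝔅
  closure_sUnion_mem : ∀ 𝔄 ⊆ 𝔅, (sSup 𝔄).topologicalClosure ∈ 𝔅

/-- `B₁ ⊊ B₂` are adjacent in `𝔅` if no member of `𝔅` lies strictly between them. -/
def AdjacentIn (𝔅 : Set (Submodule ℂ E)) (B₁ B₂ : Submodule ℂ E) : Prop :=
  B₁ < B₂ ∧ ¬ ∃ B ∈ 𝔅, B₁ < B ∧ B < B₂

/-- A reducing series is discrete if between any two distinct members `B₁ ⊊ B₂` there are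
adjacent members. -/
structure IsDiscreteReducingSeries [TopologicalSpace G] [MeasurableSpace G]
    (ν : MeasureTheory.Measure G) (π : G →* (E →L[ℂ] E)) (𝔅 : Set (Submodule ℂ E)) : Prop
    extends IsReducingSeries ν π 𝔅 where
  discrete : ∀ B₁ ∈ 𝔅, ∀ B₂ ∈ 𝔅, B₁ < B₂ →
    ∃ C₁ ∈ 𝔅, ∃ C₂ ∈ 𝔅, B₁ ≤ C₁ ∧ C₂ ≤ B₂ ∧ AdjacentIn 𝔅 C₁ C₂

end Representations

/-! ### Linear algebraic groups acting on affine varieties -/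

/-- A real linear algebraic group `G ⊆ GL(n, ℝ)` (the zero set in `GL(n, ℝ)` of polynomials in the
matrix entries) acting by matrices on a real affine algebraic variety `M ⊆ ℝⁿ`. -/
structure AffineGVariety (n : ℕ) where
  G : Subgroup (GL (Fin n) ℝ)
  M : Set (Fin n → ℝ)
  algebraic_G : ∃ S : Set (MvPolynomial (Fin n × Fin n) ℝ), ∀ g : GL (Fin n) ℝ,
    g ∈ G ↔ ∀ f ∈ S, MvPolynomial.eval (fun ij => (g : Matrix (Fin n) (Fin n) ℝ) ij.1 ij.2) f = 0
  algebraic_M : ∃ S : Set (MvPolynomial (Fin n) ℝ), ∀ m : Fin n → ℝ,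
    m ∈ M ↔ ∀ f ∈ S, MvPolynomial.eval m f = 0
  smul_mem : ∀ g ∈ G, ∀ m ∈ M, (g : Matrix (Fin n) (Fin n) ℝ) *ᵥ m ∈ M

/-- The square `r²(m) = m₁² + ⋯ + mₙ²` of the Euclidean distance to the origin. -/
def rSq {n : ℕ} (m : Fin n → ℝ) : ℝ := ∑ i, m i ^ 2

/-- The exponential of a real matrix as an invertible matrix. -/
def expGL {n : ℕ} (A : Matrix (Fin n) (Fin n) ℝ) : GL (Fin n) ℝ :=
  (Matrix.isUnit_exp A).unit

namespace AffineGVariety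

variable {n : ℕ} (V : AffineGVariety n)

/-- `G` is stable under transposition. -/
def TransposeStable : Prop :=
  ∀ g ∈ V.G, ∃ h ∈ V.G,
    (h : Matrix (Fin n) (Fin n) ℝ) = (g : Matrix (Fin n) (Fin n) ℝ)ᵀ

/-- `K` is a maximal compact subgroup of `G`. -/
def IsMaximalCompact (K : Subgroup V.G) : Prop :=
  Maximal (fun L : Subgroup V.G => IsCompact (L : Set V.G)) K

/-- The action of `G` on `M` by matrices. -/
instance : MulAction V.G V.M where
  smul g m := ⟨(g.1 : Matrix (Fin n) (Fin n) ℝ) *ᵥ m.1, V.smul_mem g.1 g.2 m.1 m.2⟩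
  one_smul m := Subtype.ext (by
    change ((1 : V.G).1 : Matrix (Fin n) (Fin n) ℝ) *ᵥ m.1 = m.1
    simp)
  mul_smul g h m := Subtype.ext (by
    change ((g * h).1 : Matrix (Fin n) (Fin n) ℝ) *ᵥ m.1
      = (g.1 : Matrix (Fin n) (Fin n) ℝ) *ᵥ ((h.1 : Matrix (Fin n) (Fin n) ℝ) *ᵥ m.1)
    simp [Matrix.mulVec_mulVec])

theorem coe_smul (g : V.G) (m : V.M) :
    ((g • m : V.M) : Fin n → ℝ) = (g.1 : Matrix (Fin n) (Fin n) ℝ) *ᵥ m.1 := rfl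

instance : ContinuousConstSMul V.G V.M where
  continuous_const_smul g := by
    refine Continuous.subtype_mk ?_ _
    fun_prop

/-- The left regular representation of `G` on `C₀(M)`: `(π(g) φ)(m) = φ(g⁻¹ m)`. -/
def π : V.G →* (C₀(V.M, ℂ) →L[ℂ] C₀(V.M, ℂ)) where
  toFun g := LinearMap.mkContinuous
    (ZeroAtInftyContinuousMap.compLinearMap (R := ℂ) (Homeomorph.smul g⁻¹).toCocompactMap) 1
    (fun φ => by
      rw [one_mul]
      refine (BoundedContinuousFunction.norm_le (norm_nonneg φ)).2 fun m => ?_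
      exact BoundedContinuousFunction.norm_coe_le_norm φ.toBCF (g⁻¹ • m))
  map_one' := by
    ext φ m
    change φ ((1 : V.G)⁻¹ • m) = φ m
    simp
  map_mul' g h := by
    ext φ m
    change φ ((g * h)⁻¹ • m) = φ (h⁻¹ • (g⁻¹ • m))
    rw [mul_inv_rev, mul_smul]

theorem π_apply (g : V.G) (φ : C₀(V.M, ℂ)) (m : V.M) : V.π g φ m = φ (g⁻¹ • m) := rfl

/-- The Lie algebra `𝔤` of `G`: all real matrices `X` with `exp(tX) ∈ G` for every real `t`. -/
def lieAlg : Set (Matrix (Fin n) (Fin n) ℝ) := {X | ∀ t : ℝ, expGL (t • X) ∈ V.G}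

/-- The one-parameter subgroup `t ↦ exp(tX)` of `G`. -/
def oneParam (X : V.lieAlg) (t : ℝ) : V.G := ⟨expGL (t • X.1), X.2 t⟩

/-- The generator `dπ(X) φ = d/dt π(exp(tX)) φ |_{t = 0}` as an operator in `C₀(M)`, with domain
the set of those `φ` for which the (norm) derivative exists. -/
def dπ (X : V.lieAlg) : C₀(V.M, ℂ) →ₗ.[ℂ] C₀(V.M, ℂ) where
  domain :=
    { carrier := {φ | DifferentiableAt ℝ (fun t : ℝ => V.π (V.oneParam X t) φ) 0}
      add_mem' := fun {φ ψ} hφ hψ => by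
        simpa only [Set.mem_ofPred_eq, map_add] using! DifferentiableAt.add hφ hψ
      zero_mem' := by simp
      smul_mem' := fun c φ hφ => by
        simpa only [Set.mem_ofPred_eq, map_smul] using! DifferentiableAt.const_smul hφ c }
  toFun :=
    { toFun := fun φ => deriv (fun t : ℝ => V.π (V.oneParam X t) φ) 0
      map_add' := fun φ ψ => by
        have h := deriv_add (𝕜 := ℝ) φ.2 ψ.2
        simpa only [Submodule.coe_add, map_add] using! h
      map_smul' := fun c φ => by
        have h := deriv_const_smul (𝕜 := ℝ) c φ.2
        simpa only [Submodule.coe_smul, map_smul] using! h }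

/-! ### Regular functions -/

/-- Restriction of complex polynomials to `M`. -/
def restrictPoly : MvPolynomial (Fin n) ℂ →ₐ[ℂ] (V.M → ℂ) :=
  MvPolynomial.aeval fun i m => ((m.1 i : ℝ) : ℂ)

/-- `ℂ[M]`, the algebra of restrictions to `M` of complex polynomials on `ℝⁿ`. -/
def regular : Subalgebra ℂ (V.M → ℂ) := V.restrictPoly.range

theorem restrictPoly_apply (P : MvPolynomial (Fin n) ℂ) (m : V.M) :
    V.restrictPoly P m = MvPolynomial.eval (fun i => ((m.1 i : ℝ) : ℂ)) P := by
  induction P using MvPolynomial.induction_on with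
  | C a => simp [restrictPoly]
  | add p q hp hq => simp [hp, hq]
  | mul_X p i hp => simp [hp]; left; simp [restrictPoly]

/-- `r²` as an element of `ℂ[M]`. -/
def rSqRegular : V.regular :=
  ⟨fun m => (rSq m.1 : ℂ), ∑ i, MvPolynomial.X i ^ 2, by
    funext m; simp [restrictPoly_apply, rSq]⟩

theorem hasDerivAt_exp_mulVec (A : Matrix (Fin n) (Fin n) ℝ) (m : Fin n → ℝ) (i : Fin n) :
    HasDerivAt (fun t : ℝ => (NormedSpace.exp (t • A) *ᵥ m) i) ((A *ᵥ m) i) 0 := by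
  let _ : NormedRing (Matrix (Fin n) (Fin n) ℝ) := Matrix.linftyOpNormedRing
  let _ : NormedAlgebra ℝ (Matrix (Fin n) (Fin n) ℝ) := Matrix.linftyOpNormedAlgebra
  have h := hasDerivAt_exp_smul_const (𝕂 := ℝ) A (0 : ℝ)
  let L : Matrix (Fin n) (Fin n) ℝ →ₗ[ℝ] ℝ :=
    { toFun := fun B => (B *ᵥ m) i
      map_add' := fun B C => by simp [Matrix.add_mulVec]
      map_smul' := fun c B => by simp [Matrix.smul_mulVec] }
  have h2 := (LinearMap.toContinuousLinearMap L).hasFDerivAt.comp_hasDerivAt (0 : ℝ) h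
  simpa [L] using! h2

/-- The derivation of the polynomial ring given by the vector field `m ↦ A m`. -/
def polyDeriv (A : Matrix (Fin n) (Fin n) ℝ) :
    Derivation ℂ (MvPolynomial (Fin n) ℂ) (MvPolynomial (Fin n) ℂ) :=
  MvPolynomial.mkDerivation ℂ fun i => ∑ j, MvPolynomial.C (A i j : ℂ) * MvPolynomial.X j

theorem hasDerivAt_poly (A : Matrix (Fin n) (Fin n) ℝ) (m : Fin n → ℝ)
    (P : MvPolynomial (Fin n) ℂ) :
    HasDerivAt (fun t : ℝ =>
        MvPolynomial.eval (fun i => (((NormedSpace.exp (t • A) *ᵥ m) i : ℝ) : ℂ)) P)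
      (MvPolynomial.eval (fun i => ((m i : ℝ) : ℂ)) (polyDeriv A P)) 0 := by
  induction P using MvPolynomial.induction_on with
  | C a => simpa using! hasDerivAt_const (0 : ℝ) a
  | add p q hp hq => simpa using! hp.add hq
  | mul_X p i hp =>
    have h := hp.mul (hasDerivAt_exp_mulVec A m i).ofReal_comp
    simp only [map_mul, MvPolynomial.eval_X, Derivation.leibniz, map_add, smul_eq_mul]
    convert! h using 1
    simp only [zero_smul, NormedSpace.exp_zero, Matrix.one_mulVec]
    simp [polyDeriv, MvPolynomial.mkDerivation_X, Matrix.mulVec, dotProduct]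
    ring

theorem coe_oneParam_inv (X : V.lieAlg) (t : ℝ) :
    (((V.oneParam X t)⁻¹ : V.G).1 : Matrix (Fin n) (Fin n) ℝ) = NormedSpace.exp (t • (-X.1)) := by
  rw [smul_neg, Matrix.exp_neg, Subgroup.coe_inv, Matrix.coe_units_inv]
  rfl

theorem deriv_mem_regular (X : V.lieAlg) (p : V.regular) :
    (fun m => deriv (fun t : ℝ => p.1 ((V.oneParam X t)⁻¹ • m)) 0) ∈ V.regular := by
  obtain ⟨P, hP⟩ := p.2
  refine ⟨polyDeriv (-X.1) P, ?_⟩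
  funext m
  change V.restrictPoly _ m = _
  have hP' : V.restrictPoly P = p.1 := hP
  rw [← hP', restrictPoly_apply]
  simp only [restrictPoly_apply, coe_smul, coe_oneParam_inv]
  exact (hasDerivAt_poly (-X.1) m.1 P).deriv.symm

/-- The differential `(dρ(X) p)(m) = d/dt p(exp(-tX) m) |_{t = 0}` of the left regular
representation `ρ` of `G` on `ℂ[M]`. -/
def dρ (X : V.lieAlg) (p : V.regular) : V.regular :=
  ⟨fun m => deriv (fun t : ℝ => p.1 ((V.oneParam X t)⁻¹ • m)) 0, V.deriv_mem_regular X p⟩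

/-- `dπ'(X) = dρ(X) - [dρ(X) r²]` on `ℂ[M]`. -/
def dπ' (X : V.lieAlg) (p : V.regular) : V.regular :=
  V.dρ X p - V.dρ X V.rSqRegular * p

/-- `dπ'(X_{k-1} ⋯ X₁ X₀) p`. -/
def iter (X : ℕ → V.lieAlg) (p : V.regular) : ℕ → V.regular
  | 0 => p
  | k + 1 => V.dπ' (X k) (iter X p k)

/-! ### The space `ℂ[M] · e^{-r²}` and the subspaces `W_p` -/

theorem continuous_regular (p : V.regular) : Continuous p.1 := by
  obtain ⟨P, hP⟩ := p.2
  have hP' : V.restrictPoly P = p.1 := hP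
  rw [← hP']
  have : (V.restrictPoly P : V.M → ℂ)
      = fun m => MvPolynomial.eval (fun i => ((m.1 i : ℝ) : ℂ)) P :=
    funext (V.restrictPoly_apply P)
  rw [this]
  refine (MvPolynomial.continuous_eval P).comp (continuous_pi fun i => ?_)
  exact Complex.continuous_ofReal.comp ((continuous_apply i).comp continuous_subtype_val)

theorem continuous_rSq : Continuous (rSq (n := n)) := by
  unfold rSq
  fun_prop

theorem rSq_nonneg (m : Fin n → ℝ) : 0 ≤ rSq m := Finset.sum_nonneg fun i _ => sq_nonneg (m i)

theorem sq_le_rSq (m : Fin n → ℝ) (i : Fin n) : m i ^ 2 ≤ rSq m :=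
  Finset.single_le_sum (f := fun i => m i ^ 2) (fun i _ => sq_nonneg (m i)) (Finset.mem_univ i)

theorem poly_le_exp (P : MvPolynomial (Fin n) ℂ) :
    ∀ ε : ℝ, 0 < ε → ∃ C : ℝ, ∀ m : Fin n → ℝ,
      ‖MvPolynomial.eval (fun i => ((m i : ℝ) : ℂ)) P‖ ≤ C * Real.exp (ε * rSq m) := by
  induction P using MvPolynomial.induction_on with
  | C a =>
    intro ε hε
    refine ⟨‖a‖, fun m => ?_⟩
    rw [MvPolynomial.eval_C]
    exact le_mul_of_one_le_right (norm_nonneg a)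
      (Real.one_le_exp (mul_nonneg hε.le (rSq_nonneg m)))
  | add p q hp hq =>
    intro ε hε
    obtain ⟨C, hC⟩ := hp ε hε
    obtain ⟨D, hD⟩ := hq ε hε
    refine ⟨C + D, fun m => ?_⟩
    rw [map_add, add_mul]
    exact (norm_add_le _ _).trans (add_le_add (hC m) (hD m))
  | mul_X p i hp =>
    intro ε hε
    obtain ⟨C, hC⟩ := hp (ε / 2) (by positivity)
    refine ⟨C * (1 + 2 / ε), fun m => ?_⟩
    have h1 : |m i| ≤ (1 + 2 / ε) * Real.exp (ε / 2 * rSq m) := by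
      have h2 : |m i| ≤ 1 + rSq m := by
        have := sq_le_rSq m i
        nlinarith [sq_abs (m i), sq_nonneg (|m i| - 1), abs_nonneg (m i)]
      have h3 : ε / 2 * rSq m ≤ Real.exp (ε / 2 * rSq m) :=
        (by linarith : ε / 2 * rSq m ≤ ε / 2 * rSq m + 1).trans (Real.add_one_le_exp _)
      have h4 : rSq m ≤ 2 / ε * Real.exp (ε / 2 * rSq m) := by
        calc rSq m = 2 / ε * (ε / 2 * rSq m) := by field_simp
          _ ≤ _ := by gcongr
      have h5 : 1 ≤ Real.exp (ε / 2 * rSq m) :=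
        Real.one_le_exp (mul_nonneg (by positivity) (rSq_nonneg m))
      linarith
    have h6 : Real.exp (ε * rSq m) = Real.exp (ε / 2 * rSq m) * Real.exp (ε / 2 * rSq m) := by
      rw [← Real.exp_add]
      congr 1
      ring
    rw [map_mul, MvPolynomial.eval_X, norm_mul, Complex.norm_real, Real.norm_eq_abs, h6]
    calc _ ≤ (C * Real.exp (ε / 2 * rSq m)) * ((1 + 2 / ε) * Real.exp (ε / 2 * rSq m)) :=
          mul_le_mul (hC m) h1 (abs_nonneg _) ((norm_nonneg _).trans (hC m))
      _ = _ := by ring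

theorem isClosed_M : IsClosed V.M := by
  obtain ⟨S, hS⟩ := V.algebraic_M
  have : V.M = ⋂ f ∈ S, {m | MvPolynomial.eval m f = 0} := by
    ext m
    simp [hS]
  rw [this]
  exact isClosed_biInter fun f _ =>
    isClosed_eq (MvPolynomial.continuous_eval f) continuous_const

theorem gauss_tendsto (p : V.regular) :
    Filter.Tendsto (fun m : V.M => p.1 m * (Real.exp (-rSq m.1) : ℂ))
      (Filter.cocompact V.M) (nhds 0) := by
  obtain ⟨P, hP⟩ := p.2
  have hP' : V.restrictPoly P = p.1 := hP
  obtain ⟨C, hC⟩ := poly_le_exp P (1 / 2) (by norm_num)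
  have h1 : Filter.Tendsto (fun m : V.M => rSq m.1) (Filter.cocompact V.M) Filter.atTop := by
    have h2 : Filter.Tendsto (fun m : V.M => ‖m.1‖) (Filter.cocompact V.M) Filter.atTop :=
      (tendsto_norm_cocompact_atTop (E := Fin n → ℝ)).comp
        V.isClosed_M.isClosedEmbedding_subtypeVal.tendsto_cocompact
    refine Filter.tendsto_atTop_mono (fun m => ?_) (Filter.tendsto_atTop_add_const_right _ (-1) h2)
    have h3 : ‖m.1‖ ≤ rSq m.1 + 1 := by
      refine (pi_norm_le_iff_of_nonneg (by have := rSq_nonneg m.1; linarith)).2 fun i => ?_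
      have := sq_le_rSq m.1 i
      rw [Real.norm_eq_abs]
      nlinarith [sq_abs (m.1 i), sq_nonneg (|m.1 i| - 1), abs_nonneg (m.1 i)]
    linarith
  have h4 : Filter.Tendsto (fun m : V.M => C * Real.exp (-(1 / 2 * rSq m.1)))
      (Filter.cocompact V.M) (nhds 0) := by
    have := (Real.tendsto_exp_neg_atTop_nhds_zero.comp
      (h1.const_mul_atTop (show (0 : ℝ) < 1 / 2 by norm_num))).const_mul C
    simpa using! this
  refine squeeze_zero_norm (fun m => ?_) h4
  rw [← hP', restrictPoly_apply, norm_mul, Complex.norm_real, Real.norm_eq_abs, Real.abs_exp]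
  calc _ ≤ (C * Real.exp (1 / 2 * rSq m.1)) * Real.exp (-rSq m.1) := by
        gcongr
        exact hC m.1
    _ = _ := by
        rw [mul_assoc, ← Real.exp_add]
        congr 2
        ring

/-- The element `p · e^{-r²}` of `C₀(M)`, for `p ∈ ℂ[M]`. -/
def gauss (p : V.regular) : C₀(V.M, ℂ) where
  toFun m := p.1 m * (Real.exp (-rSq m.1) : ℂ)
  continuous_toFun := by
    refine (V.continuous_regular p).mul (Complex.continuous_ofReal.comp ?_)
    exact Real.continuous_exp.comp (continuous_rSq.comp continuous_subtype_val).neg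
  zero_at_infty' := V.gauss_tendsto p

/-- `W_p = dπ(𝔘(𝔤_ℂ)) Span {π(K) (p · e^{-r²})}`: the smallest complex subspace of `C₀(M)` that
contains `π(k) (p · e^{-r²})` for all `k ∈ K` and is invariant under the operators `dπ(X)`,
`X ∈ 𝔤`. (The image of `𝔘(𝔤_ℂ)` is the unital complex algebra generated by these operators.) -/
def W (K : Subgroup V.G) (p : V.regular) : Submodule ℂ C₀(V.M, ℂ) :=
  sInf {W | (∀ k ∈ K, V.π k (V.gauss p) ∈ W) ∧
    ∀ (X : V.lieAlg) (φ : (V.dπ X).domain), (φ : C₀(V.M, ℂ)) ∈ W → V.dπ X φ ∈ W}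

end AffineGVariety

end

/-!
The elements of `W_p` all have the form `q · e^{-r²}` with `q ∈ ℂ[M]`, and `dπ(X)` acts on them as
`dπ'(X)` acts on `q`. The main point is that they are analytic vectors. For a real matrix `A` the
function `z ↦ (q e^{-r²})(exp(zA) m)` is entire, and on a disc `|z| ≤ δ`, with `δ` depending on `A`
only, it is bounded uniformly in `m`: there the real part of `r²(exp(zA) m)` is at least
`r²(m) / 2`, while `q(exp(zA) m)` is dominated by a Gaussian with a small exponent
(`exists_radius_gaussFlow`). By Cauchy's estimates the Taylor series of
`t ↦ π(exp(tX)) (q e^{-r²})` then converges in the sup norm for `|t| < δ`, with the coefficients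
`dπ(X)^k (q e^{-r²}) / k!` (`AffineGVariety.exists_radius_hasSum_gauss`). These lie in `W_p` as soon
as `q e^{-r²}` does, so the closure of `W_p` is invariant under `exp(tX)` for small `t`, and hence
for all `t`.

Since `π(k) dπ(X) = dπ(Ad(k) X) π(k)`, the space `W_p` is also `K`-invariant
(`AffineGVariety.π_mem_W`), and in particular `W_{dπ'(X)p} ⊆ W_p`. A maximal compact subgroup that
preserves `r²` equals `G ∩ O(n)`, and `G = (G ∩ O(n)) exp(𝔤)` because the positive definite matrix
`gᵀg ∈ G` has its logarithm in `𝔤`: a polynomial that vanishes on the powers of a positive definite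
matrix vanishes on its whole one-parameter group
(`AffineGVariety.exists_polar_decomposition`). So the closure of `W_p` is `G`-invariant.

What remains is formal. Closed invariant subspaces are stable under `π(C_c(G))`, and a descending
sequence of closed subspaces together with its intersection and `0` is well-ordered by reverse
inclusion, which gives a discrete reducing series (`Antitone.isDiscreteReducingSeries`).
-/

noncomputable section

/-! ### Descending sequences and discrete reducing series -/

section OrderTheory

variable {α : Type*} [CompleteLattice α] {C : ℕ → α} {S : Set α}

theorem Antitone.isChain_range_union_iInf_bot (hC : Antitone C) :
    IsChain (· ≤ ·) (Set.range C ∪ {⨅ k, C k, ⊥}) := by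
  rintro a (⟨i, rfl⟩ | rfl | rfl) b (⟨j, rfl⟩ | rfl | rfl) -
  · exact (le_total j i).imp (hC ·) (hC ·)
  · exact Or.inr (iInf_le C i)
  · exact Or.inr bot_le
  · exact Or.inl (iInf_le C j)
  · exact Or.inl le_rfl
  · exact Or.inr bot_le
  all_goals exact Or.inl bot_le

/-- A descending sequence, completed by its infimum and `⊥`, is well-ordered by `≥`. -/
theorem Antitone.exists_isGreatest (hC : Antitone C)
    (hS : S ⊆ Set.range C ∪ {⨅ k, C k, ⊥}) (hne : S.Nonempty) : ∃ a, IsGreatest S a := by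
  classical
  by_cases h : ∃ k, C k ∈ S
  · refine ⟨C (Nat.find h), Nat.find_spec h, fun b hb => ?_⟩
    rcases hS hb with ⟨j, rfl⟩ | rfl | rfl
    · exact hC (Nat.find_min' h hb)
    · exact iInf_le C _
    · exact bot_le
  · by_cases h' : (⨅ k, C k) ∈ S
    · refine ⟨_, h', fun b hb => ?_⟩
      rcases hS hb with ⟨j, rfl⟩ | rfl | rfl
      · exact absurd ⟨j, hb⟩ h
      · exact le_rfl
      · exact bot_le
    · obtain ⟨a, ha⟩ := hne
      have hbot : ∀ b ∈ S, b = ⊥ := fun b hb => by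
        rcases hS hb with ⟨j, rfl⟩ | rfl | rfl
        · exact absurd ⟨j, hb⟩ h
        · exact absurd hb h'
        · rfl
      exact ⟨a, ha, fun b hb => (hbot b hb).trans_le bot_le⟩

theorem Antitone.sInf_mem_range_union_iInf_bot (hC : Antitone C) (h0 : C 0 = ⊤)
    (hS : S ⊆ Set.range C ∪ {⨅ k, C k, ⊥}) :
    sInf S ∈ Set.range C ∪ {⨅ k, C k, ⊥} := by
  classical
  by_cases hb : ⊥ ∈ S
  · exact Or.inr (Or.inr (le_bot_iff.1 (sInf_le hb)))
  have hge : ⨅ k, C k ≤ sInf S := le_sInf fun a ha => by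
    rcases hS ha with ⟨j, rfl⟩ | rfl | rfl
    · exact iInf_le C j
    · exact le_rfl
    · exact absurd ha hb
  by_cases h : ∀ k, sInf S ≤ C k
  · exact Or.inr (Or.inl (le_antisymm (le_iInf h) hge))
  push Not at h
  -- the first term that does not bound `sInf S` comes right after the term equal to `sInf S`
  obtain ⟨k, hk⟩ : ∃ k, Nat.find h = k + 1 := by
    refine Nat.exists_eq_succ_of_ne_zero fun h00 => Nat.find_spec h ?_
    rw [h00, h0]
    exact le_top
  refine Or.inl ⟨k, le_antisymm (le_sInf fun a ha => ?_)
    (not_not.1 (Nat.find_min h (hk ▸ k.lt_succ_self)))⟩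
  have hlt : ¬ a ≤ C (k + 1) := fun hle => Nat.find_spec h (hk ▸ (sInf_le ha).trans hle)
  rcases hS ha with ⟨j, rfl⟩ | rfl | rfl
  · exact hC (by by_contra hj; exact hlt (hC (by omega)))
  · exact absurd (iInf_le C _) hlt
  · exact absurd bot_le hlt

end OrderTheory

section Series

variable {G : Type*} [Group G] [TopologicalSpace G] [MeasurableSpace G]
  {E : Type*} [NormedAddCommGroup E] [NormedSpace ℂ E] [CompleteSpace E]

theorem isCcStable_of_isClosed (ν : MeasureTheory.Measure G) (π : G →* (E →L[ℂ] E))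
    {A : Submodule ℂ E} (hA : IsClosed (A : Set E)) (hinv : ∀ g, ∀ φ ∈ A, π g φ ∈ A) :
    IsCcStable ν π A := by
  intro f _ _ φ hφ
  have : CompleteSpace A := hA.completeSpace_coe
  have h : ∫ g, f g • π g φ ∂ν
      = (∫ g, (⟨f g • π g φ, A.smul_mem _ (hinv g φ hφ)⟩ : A) ∂ν : A) :=
    A.subtypeₗᵢ.integral_comp_comm (μ := ν)
      fun g => (⟨f g • π g φ, A.smul_mem _ (hinv g φ hφ)⟩ : A)
  rw [h]
  exact Subtype.prop _

/-- A descending sequence of closed invariant subspaces that starts with the whole space becomes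
a discrete reducing series once its intersection and `0` are added: every non-empty subfamily has
a largest member, so that the closure of its union is that member, and the largest member strictly
below a given one is adjacent to it. -/
theorem Antitone.isDiscreteReducingSeries {C : ℕ → Submodule ℂ E} (hC : Antitone C)
    (ν : MeasureTheory.Measure G) (π : G →* (E →L[ℂ] E)) (h0 : C 0 = ⊤)
    (hcl : ∀ k, IsClosed (C k : Set E)) (hinv : ∀ k g, ∀ φ ∈ C k, π g φ ∈ C k) :
    IsDiscreteReducingSeries ν π (Set.range C ∪ {⨅ k, C k, ⊥}) := by
  have hclosed : ∀ A ∈ Set.range C ∪ {⨅ k, C k, ⊥}, IsClosed (A : Set E) := by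
    rintro A (⟨k, rfl⟩ | rfl | rfl)
    · exact hcl k
    · rw [Submodule.coe_iInf]
      exact isClosed_iInter hcl
    · simp
  have hinv' : ∀ A ∈ Set.range C ∪ {⨅ k, C k, ⊥}, ∀ g, ∀ φ ∈ A, π g φ ∈ A := by
    rintro A (⟨k, rfl⟩ | rfl | rfl) g φ hφ
    · exact hinv k g φ hφ
    · rw [Submodule.mem_iInf] at hφ ⊢
      exact fun k => hinv k g φ (hφ k)
    · rw [Submodule.mem_bot] at hφ ⊢
      rw [hφ, map_zero]
  have hbot : (⊥ : Submodule ℂ E) ∈ Set.range C ∪ {⨅ k, C k, ⊥} := Or.inr (Or.inr rfl)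
  refine ⟨⟨hC.isChain_range_union_iInf_bot, hclosed,
    fun A hA => isCcStable_of_isClosed ν π (hclosed A hA) (hinv' A hA), hbot,
    Or.inl ⟨0, h0⟩, fun S hS => hC.sInf_mem_range_union_iInf_bot h0 hS, fun S hS => ?_⟩, ?_⟩
  · rcases S.eq_empty_or_nonempty with rfl | hne
    · rw [sSup_empty, (hclosed ⊥ hbot).submodule_topologicalClosure_eq]
      exact hbot
    · obtain ⟨A, hA⟩ := hC.exists_isGreatest hS hne
      rw [hA.isLUB.sSup_eq, (hclosed A (hS hA.1)).submodule_topologicalClosure_eq]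
      exact hS hA.1
  · intro B₁ h₁ B₂ h₂ hlt
    obtain ⟨A, ⟨hA, hAlt⟩, hmax⟩ := hC.exists_isGreatest
      (S := {A | A ∈ Set.range C ∪ {⨅ k, C k, ⊥} ∧ A < B₂}) (fun A hA => hA.1) ⟨B₁, h₁, hlt⟩
    exact ⟨A, hA, B₂, h₂, hmax ⟨h₁, hlt⟩, le_rfl, hAlt,
      fun ⟨D, hD, hAD, hDB⟩ => hAD.not_ge (hmax ⟨hD, hDB⟩)⟩

/-- The finite version of `Antitone.isDiscreteReducingSeries`: the sequence is made constant from
the index `N` on. -/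
theorem Antitone.isDiscreteReducingSeries_finite {C : ℕ → Submodule ℂ E} (hC : Antitone C)
    (ν : MeasureTheory.Measure G) (π : G →* (E →L[ℂ] E)) (h0 : C 0 = ⊤)
    (hcl : ∀ k, IsClosed (C k : Set E)) (hinv : ∀ k g, ∀ φ ∈ C k, π g φ ∈ C k) (N : ℕ) :
    IsDiscreteReducingSeries ν π ({A | ∃ k ≤ N, A = C k} ∪ {⊥}) := by
  have hinf : ⨅ k, C (min k N) = C N :=
    le_antisymm ((iInf_le _ N).trans_eq (by simp)) (le_iInf fun k => hC (min_le_right k N))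
  have hD : Antitone fun k => C (min k N) := fun i j hij => hC (min_le_min_right N hij)
  convert hD.isDiscreteReducingSeries ν π (by simpa using h0) (fun k => hcl _)
    (fun k => hinv _) using 1
  rw [hinf]
  ext A
  constructor
  · rintro (⟨k, hk, rfl⟩ | h)
    · exact Or.inl ⟨k, by simp [hk]⟩
    · exact Or.inr (Or.inr h)
  · rintro (⟨k, rfl⟩ | rfl | h)
    · exact Or.inl ⟨_, min_le_right k N, rfl⟩
    · exact Or.inl ⟨N, le_rfl, rfl⟩
    · exact Or.inr h

end Series

/-! ### The linear flow in complex time -/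

section ComplexFlow

variable {n : ℕ}

/-- The curve `z ↦ exp(zA) m` in `ℂⁿ`, for a real matrix `A`, a real point `m` and complex
time `z`. -/
def complexFlow (A : Matrix (Fin n) (Fin n) ℝ) (m : Fin n → ℝ) (z : ℂ) : Fin n → ℂ :=
  NormedSpace.exp (z • A.map Complex.ofReal) *ᵥ fun i => (m i : ℂ)

/-- The polynomial `x₁² + ⋯ + xₙ²`. -/
def rSqPoly (n : ℕ) : MvPolynomial (Fin n) ℂ := ∑ i, MvPolynomial.X i ^ 2

/-- The entire function `z ↦ (P e^{-r²})(exp(zA) m)`, where `r²` is continued to `ℂⁿ` as a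
polynomial. -/
def gaussFlow (A : Matrix (Fin n) (Fin n) ℝ) (P : MvPolynomial (Fin n) ℂ) (m : Fin n → ℝ)
    (z : ℂ) : ℂ :=
  MvPolynomial.eval (complexFlow A m z) P
    * Complex.exp (-MvPolynomial.eval (complexFlow A m z) (rSqPoly n))

/-- The operator `P ↦ e^{r²} ξ(P e^{-r²}) = ξP - (ξr²)P`, where `ξ` is the derivation given by
the vector field `m ↦ A m`. -/
def gaussDeriv (A : Matrix (Fin n) (Fin n) ℝ) (P : MvPolynomial (Fin n) ℂ) :
    MvPolynomial (Fin n) ℂ :=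
  AffineGVariety.polyDeriv A P - AffineGVariety.polyDeriv A (rSqPoly n) * P

theorem complexFlow_zero (A : Matrix (Fin n) (Fin n) ℝ) (m : Fin n → ℝ) :
    complexFlow A m 0 = fun i => (m i : ℂ) := by
  simp [complexFlow]

theorem hasDerivAt_complexFlow (A : Matrix (Fin n) (Fin n) ℝ) (m : Fin n → ℝ) (z : ℂ)
    (i : Fin n) :
    HasDerivAt (fun z => complexFlow A m z i) (∑ j, (A i j : ℂ) * complexFlow A m z j) z := by
  let _ : NormedRing (Matrix (Fin n) (Fin n) ℂ) := Matrix.linftyOpNormedRing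
  let _ : NormedAlgebra ℂ (Matrix (Fin n) (Fin n) ℂ) := Matrix.linftyOpNormedAlgebra
  have h := hasDerivAt_exp_smul_const' (𝕂 := ℂ) (A.map Complex.ofReal) z
  let L : Matrix (Fin n) (Fin n) ℂ →ₗ[ℂ] ℂ :=
    { toFun := fun B => (B *ᵥ fun i => (m i : ℂ)) i
      map_add' := fun B C => by simp [Matrix.add_mulVec]
      map_smul' := fun c B => by simp [Matrix.smul_mulVec] }
  have h2 := (LinearMap.toContinuousLinearMap L).hasFDerivAt.comp_hasDerivAt z h
  have h3 : L (A.map Complex.ofReal * NormedSpace.exp (z • A.map Complex.ofReal))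
      = ∑ j, (A i j : ℂ) * complexFlow A m z j := by
    change ((A.map Complex.ofReal * NormedSpace.exp (z • A.map Complex.ofReal)) *ᵥ _) i = _
    rw [← Matrix.mulVec_mulVec]
    rfl
  exact h3 ▸ h2

theorem hasDerivAt_eval_complexFlow (A : Matrix (Fin n) (Fin n) ℝ) (m : Fin n → ℝ)
    (P : MvPolynomial (Fin n) ℂ) (z : ℂ) :
    HasDerivAt (fun z => MvPolynomial.eval (complexFlow A m z) P)
      (MvPolynomial.eval (complexFlow A m z) (AffineGVariety.polyDeriv A P)) z := by
  induction P using MvPolynomial.induction_on with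
  | C a => simpa using! hasDerivAt_const z a
  | add p q hp hq => simpa using! hp.add hq
  | mul_X p i hp =>
    have h := hp.mul (hasDerivAt_complexFlow A m z i)
    simp only [map_mul, MvPolynomial.eval_X, Derivation.leibniz, map_add, smul_eq_mul]
    convert! h using 1
    simp [AffineGVariety.polyDeriv, MvPolynomial.mkDerivation_X]
    ring

theorem hasDerivAt_gaussFlow (A : Matrix (Fin n) (Fin n) ℝ) (P : MvPolynomial (Fin n) ℂ)
    (m : Fin n → ℝ) (z : ℂ) :
    HasDerivAt (gaussFlow A P m) (gaussFlow A (gaussDeriv A P) m z) z := by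
  have h := (hasDerivAt_eval_complexFlow A m P z).mul
    (hasDerivAt_eval_complexFlow A m (rSqPoly n) z).neg.cexp
  convert! h using 1
  simp only [gaussFlow, gaussDeriv, map_sub, map_mul, Pi.neg_apply]
  ring

theorem differentiable_gaussFlow (A : Matrix (Fin n) (Fin n) ℝ) (P : MvPolynomial (Fin n) ℂ)
    (m : Fin n → ℝ) : Differentiable ℂ (gaussFlow A P m) :=
  fun z => (hasDerivAt_gaussFlow A P m z).differentiableAt

theorem iteratedDeriv_gaussFlow (A : Matrix (Fin n) (Fin n) ℝ) (P : MvPolynomial (Fin n) ℂ)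
    (m : Fin n → ℝ) (k : ℕ) :
    iteratedDeriv k (gaussFlow A P m) = gaussFlow A ((gaussDeriv A)^[k] P) m := by
  induction k with
  | zero => simp
  | succ k ih =>
    rw [iteratedDeriv_succ, ih, Function.iterate_succ_apply']
    exact funext fun z => (hasDerivAt_gaussFlow A _ m z).deriv

theorem complexFlow_ofReal (A : Matrix (Fin n) (Fin n) ℝ) (m : Fin n → ℝ) (t : ℝ) :
    complexFlow A m (t : ℂ) = fun i => (((NormedSpace.exp (t • A) *ᵥ m) i : ℝ) : ℂ) := by
  let _ : NormedRing (Matrix (Fin n) (Fin n) ℝ) := Matrix.linftyOpNormedRing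
  let _ : NormedAlgebra ℝ (Matrix (Fin n) (Fin n) ℝ) := Matrix.linftyOpNormedAlgebra
  let _ : NormedAlgebra ℚ (Matrix (Fin n) (Fin n) ℝ) := NormedAlgebra.restrictScalars ℚ ℝ _
  let _ : NormedRing (Matrix (Fin n) (Fin n) ℂ) := Matrix.linftyOpNormedRing
  let _ : NormedAlgebra ℂ (Matrix (Fin n) (Fin n) ℂ) := Matrix.linftyOpNormedAlgebra
  let f : Matrix (Fin n) (Fin n) ℝ →+* Matrix (Fin n) (Fin n) ℂ := Complex.ofRealHom.mapMatrix
  have hf : Continuous f := by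
    change Continuous fun M : Matrix (Fin n) (Fin n) ℝ => M.map Complex.ofReal
    exact Continuous.matrix_map continuous_id Complex.continuous_ofReal
  have h : f (NormedSpace.exp (t • A)) = NormedSpace.exp (f (t • A)) := NormedSpace.map_exp f hf _
  have h2 : f (t • A) = (t : ℂ) • A.map Complex.ofReal := by
    ext i j
    simp [f]
  rw [h2] at h
  funext i
  rw [complexFlow, ← h]
  simp [f, Matrix.mulVec, dotProduct]

theorem eval_rSqPoly (w : Fin n → ℂ) : MvPolynomial.eval w (rSqPoly n) = ∑ i, w i ^ 2 := by
  simp [rSqPoly]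

theorem gaussFlow_ofReal (A : Matrix (Fin n) (Fin n) ℝ) (P : MvPolynomial (Fin n) ℂ)
    (m : Fin n → ℝ) (t : ℝ) :
    gaussFlow A P m t
      = MvPolynomial.eval (fun i => (((NormedSpace.exp (t • A) *ᵥ m) i : ℝ) : ℂ)) P
        * (Real.exp (-rSq (NormedSpace.exp (t • A) *ᵥ m)) : ℂ) := by
  rw [gaussFlow, complexFlow_ofReal, eval_rSqPoly]
  simp [rSq]

/-- A polynomial is dominated on `ℂⁿ` by every Gaussian `e^{ε|w|²}`. -/
theorem norm_eval_le_exp (P : MvPolynomial (Fin n) ℂ) :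
    ∀ ε : ℝ, 0 < ε → ∃ C : ℝ, 0 ≤ C ∧ ∀ w : Fin n → ℂ,
      ‖MvPolynomial.eval w P‖ ≤ C * Real.exp (ε * ∑ i, ‖w i‖ ^ 2) := by
  induction P using MvPolynomial.induction_on with
  | C a =>
    intro ε hε
    refine ⟨‖a‖, norm_nonneg a, fun w => ?_⟩
    rw [MvPolynomial.eval_C]
    exact le_mul_of_one_le_right (norm_nonneg a) (Real.one_le_exp (by positivity))
  | add p q hp hq =>
    intro ε hε
    obtain ⟨C, hC0, hC⟩ := hp ε hε
    obtain ⟨D, hD0, hD⟩ := hq ε hε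
    refine ⟨C + D, by positivity, fun w => ?_⟩
    rw [map_add, add_mul]
    exact (norm_add_le _ _).trans (add_le_add (hC w) (hD w))
  | mul_X p i hp =>
    intro ε hε
    obtain ⟨C, hC0, hC⟩ := hp (ε / 2) (by positivity)
    refine ⟨C * (1 + 2 / ε), by positivity, fun w => ?_⟩
    set s := ∑ i, ‖w i‖ ^ 2 with hs
    have hs0 : 0 ≤ s := by positivity
    have h1 : ‖w i‖ ≤ (1 + 2 / ε) * Real.exp (ε / 2 * s) := by
      have h2 : ‖w i‖ ≤ 1 + s := by
        have : ‖w i‖ ^ 2 ≤ s := Finset.single_le_sum (f := fun i => ‖w i‖ ^ 2)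
          (fun i _ => by positivity) (Finset.mem_univ i)
        nlinarith [sq_nonneg (‖w i‖ - 1)]
      have h4 : s ≤ 2 / ε * Real.exp (ε / 2 * s) := by
        calc s = 2 / ε * (ε / 2 * s) := by field_simp
          _ ≤ _ := by
            gcongr
            linarith [Real.add_one_le_exp (ε / 2 * s)]
      have h5 : 1 ≤ Real.exp (ε / 2 * s) := Real.one_le_exp (by positivity)
      linarith
    have h6 : Real.exp (ε * s) = Real.exp (ε / 2 * s) * Real.exp (ε / 2 * s) := by
      rw [← Real.exp_add]
      congr 1
      ring
    rw [map_mul, MvPolynomial.eval_X, norm_mul, h6]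
    calc _ ≤ (C * Real.exp (ε / 2 * s)) * ((1 + 2 / ε) * Real.exp (ε / 2 * s)) := by
          gcongr
          exact hC w
      _ = _ := by ring

/-- The values of a quadratic form are bounded by the sum of the norms of its coefficients. -/
theorem norm_sum_mul_mul_le (Q : Fin n → Fin n → ℂ) (m : Fin n → ℝ) :
    ‖∑ j, ∑ k, Q j k * (m j * m k)‖ ≤ (∑ j, ∑ k, ‖Q j k‖) * rSq m := by
  simp_rw [Finset.sum_mul]
  refine (norm_sum_le _ _).trans (Finset.sum_le_sum fun j _ =>
    (norm_sum_le _ _).trans (Finset.sum_le_sum fun k _ => ?_))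
  rw [norm_mul, norm_mul, Complex.norm_real, Complex.norm_real, Real.norm_eq_abs,
    Real.norm_eq_abs]
  gcongr
  have hj := AffineGVariety.sq_le_rSq m j
  have hk := AffineGVariety.sq_le_rSq m k
  nlinarith [sq_abs (m j), sq_abs (m k), sq_nonneg (|m j| - |m k|)]

/-- For small complex times the real part of `r²(exp(zA) m)` is at least `r²(m) / 2`, and the
Hermitian norm of `exp(zA) m` is comparable to that of `m`. -/
theorem exists_radius_complexFlow (A : Matrix (Fin n) (Fin n) ℝ) :
    ∃ δ : ℝ, 0 < δ ∧ ∃ D : ℝ, 0 < D ∧ ∀ z : ℂ, ‖z‖ ≤ δ → ∀ m : Fin n → ℝ,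
      1 / 2 * rSq m ≤ (∑ i, complexFlow A m z i ^ 2).re ∧
      ∑ i, ‖complexFlow A m z i‖ ^ 2 ≤ D * rSq m := by
  let _ : NormedRing (Matrix (Fin n) (Fin n) ℂ) := Matrix.linftyOpNormedRing
  let _ : NormedAlgebra ℂ (Matrix (Fin n) (Fin n) ℂ) := Matrix.linftyOpNormedAlgebra
  set E : ℂ → Matrix (Fin n) (Fin n) ℂ := fun z => NormedSpace.exp (z • A.map Complex.ofReal)
    with hE
  have hEc : Continuous E := continuous_iff_continuousAt.2 fun z =>
    (hasDerivAt_exp_smul_const (𝕂 := ℂ) (A.map Complex.ofReal) z).continuousAt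
  have hEc' : ∀ i j, Continuous fun z => E z i j := fun i j =>
    (continuous_apply_apply i j).comp hEc
  have hE0 : E 0 = 1 := by simp [hE]
  -- the coefficients of the quadratic form `r²(exp(zA) m) - r²(m)`
  set Q : ℂ → Fin n → Fin n → ℂ := fun z j k =>
    ∑ i, E z i j * E z i k - (1 : Matrix (Fin n) (Fin n) ℂ) j k with hQ
  have hQc : Continuous fun z => ∑ j, ∑ k, ‖Q z j k‖ := by
    simp only [hQ]
    fun_prop
  have hQ0 : ∑ j, ∑ k, ‖Q 0 j k‖ = 0 := by
    refine Finset.sum_eq_zero fun j _ => Finset.sum_eq_zero fun k _ => ?_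
    rcases eq_or_ne k j with rfl | h
    · simp [hQ, hE0, Matrix.one_apply]
    · simp [hQ, hE0, Matrix.one_apply, h, h.symm]
  set S : ℂ → ℝ := fun z => ∑ i, (∑ j, ‖E z i j‖) ^ 2 with hS
  have hSc : Continuous S := by
    simp only [hS]
    fun_prop
  have h1 : ∀ᶠ z in nhds (0 : ℂ), ∑ j, ∑ k, ‖Q z j k‖ < 1 / 2 :=
    hQc.continuousAt.eventually_lt continuousAt_const (by rw [hQ0]; norm_num)
  have h2 : ∀ᶠ z in nhds (0 : ℂ), S z < S 0 + 1 :=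
    hSc.continuousAt.eventually_lt continuousAt_const (by simp)
  obtain ⟨δ, hδ, hball⟩ := Metric.eventually_nhds_iff_ball.1 (h1.and h2)
  refine ⟨δ / 2, by positivity, S 0 + 1, by positivity, fun z hz m => ?_⟩
  obtain ⟨hz1, hz2⟩ := hball z (by rw [mem_ball_zero_iff]; linarith)
  have hm := AffineGVariety.rSq_nonneg m
  constructor
  · have key : ∑ i, complexFlow A m z i ^ 2
        = (rSq m : ℂ) + ∑ j, ∑ k, Q z j k * (m j * m k) := by
      have e1 : ∀ i, complexFlow A m z i ^ 2
          = ∑ j, ∑ k, E z i j * E z i k * (m j * m k) := fun i => by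
        have : complexFlow A m z i = ∑ j, E z i j * (m j : ℂ) := rfl
        rw [this, sq, Finset.sum_mul_sum]
        refine Finset.sum_congr rfl fun j _ => Finset.sum_congr rfl fun k _ => ?_
        ring
      have e2 : (rSq m : ℂ) = ∑ j, ∑ k, (1 : Matrix (Fin n) (Fin n) ℂ) j k * (m j * m k) := by
        simp [rSq, Matrix.one_apply, sq]
      simp_rw [e1]
      rw [e2, ← Finset.sum_add_distrib, Finset.sum_comm]
      refine Finset.sum_congr rfl fun j _ => ?_
      rw [← Finset.sum_add_distrib, Finset.sum_comm]
      refine Finset.sum_congr rfl fun k _ => ?_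
      rw [← Finset.sum_mul]
      simp only [hQ]
      ring
    have h3 := norm_sum_mul_mul_le (Q z) m
    have h4 := (Complex.abs_re_le_norm _).trans h3
    rw [key, Complex.add_re, Complex.ofReal_re]
    have h5 := neg_abs_le (∑ j, ∑ k, Q z j k * (m j * m k) : ℂ).re
    nlinarith
  · calc ∑ i, ‖complexFlow A m z i‖ ^ 2
        ≤ ∑ i, (∑ j, ‖E z i j‖) ^ 2 * rSq m := by
          refine Finset.sum_le_sum fun i _ => ?_
          have h3 : ‖complexFlow A m z i‖ ≤ (∑ j, ‖E z i j‖) * √(rSq m) := by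
            have e : complexFlow A m z i = ∑ j, E z i j * (m j : ℂ) := rfl
            rw [Finset.sum_mul, e]
            refine (norm_sum_le _ _).trans (Finset.sum_le_sum fun j _ => ?_)
            rw [norm_mul, Complex.norm_real]
            gcongr
            exact Real.abs_le_sqrt (AffineGVariety.sq_le_rSq m j)
          calc _ ≤ ((∑ j, ‖E z i j‖) * √(rSq m)) ^ 2 := by gcongr
            _ = _ := by rw [mul_pow, Real.sq_sqrt hm]
      _ = S z * rSq m := by rw [Finset.sum_mul]
      _ ≤ _ := by gcongr

/-- On a disc whose radius depends on `A` only, the functions `z ↦ (P e^{-r²})(exp(zA) m)` are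
bounded uniformly in `m`. -/
theorem exists_radius_gaussFlow (A : Matrix (Fin n) (Fin n) ℝ) :
    ∃ δ : ℝ, 0 < δ ∧ ∀ P : MvPolynomial (Fin n) ℂ, ∃ C : ℝ, 0 ≤ C ∧
      ∀ m : Fin n → ℝ, ∀ z : ℂ, ‖z‖ ≤ δ → ‖gaussFlow A P m z‖ ≤ C := by
  obtain ⟨δ, hδ, D, hD, h⟩ := exists_radius_complexFlow A
  refine ⟨δ, hδ, fun P => ?_⟩
  -- this exponent turns `e^{ε|w|²}` into at most `e^{r²(m)/2}`
  obtain ⟨C, hC0, hC⟩ := norm_eval_le_exp P (1 / (2 * D)) (by positivity)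
  refine ⟨C, hC0, fun m z hz => ?_⟩
  obtain ⟨h1, h2⟩ := h z hz m
  rw [gaussFlow, norm_mul, Complex.norm_exp, Complex.neg_re, eval_rSqPoly]
  calc _ ≤ (C * Real.exp (1 / (2 * D) * (D * rSq m))) * Real.exp (-(1 / 2 * rSq m)) := by
        gcongr
        refine (hC _).trans ?_
        gcongr
    _ = C := by
        rw [mul_assoc, ← Real.exp_add]
        have : 1 / (2 * D) * (D * rSq m) + -(1 / 2 * rSq m) = 0 := by
          field_simp
          ring
        rw [this, Real.exp_zero, mul_one]

end ComplexFlow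

/-! ### The functions `q · e^{-r²}` are analytic vectors -/

namespace AffineGVariety

variable {n : ℕ} (V : AffineGVariety n)

theorem restrictPoly_polyDeriv (X : V.lieAlg) {P : MvPolynomial (Fin n) ℂ} {p : V.regular}
    (hP : V.restrictPoly P = p.1) :
    V.restrictPoly (polyDeriv (-X.1) P) = (V.dρ X p).1 := by
  funext m
  change _ = deriv (fun t : ℝ => p.1 ((V.oneParam X t)⁻¹ • m)) 0
  rw [← hP, restrictPoly_apply]
  simp only [restrictPoly_apply, coe_smul, coe_oneParam_inv]
  exact (hasDerivAt_poly (-X.1) m.1 P).deriv.symm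

theorem restrictPoly_rSqPoly : V.restrictPoly (rSqPoly n) = V.rSqRegular.1 := by
  funext m
  simp [restrictPoly_apply, eval_rSqPoly, rSqRegular, rSq]

theorem restrictPoly_gaussDeriv (X : V.lieAlg) {P : MvPolynomial (Fin n) ℂ} {p : V.regular}
    (hP : V.restrictPoly P = p.1) :
    V.restrictPoly (gaussDeriv (-X.1) P) = (V.dπ' X p).1 := by
  rw [gaussDeriv, map_sub, map_mul, V.restrictPoly_polyDeriv X hP,
    V.restrictPoly_polyDeriv X V.restrictPoly_rSqPoly, hP]
  rfl

theorem restrictPoly_gaussDeriv_iterate (X : V.lieAlg) {P : MvPolynomial (Fin n) ℂ}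
    {p : V.regular} (hP : V.restrictPoly P = p.1) (k : ℕ) :
    V.restrictPoly ((gaussDeriv (-X.1))^[k] P) = ((V.dπ' X)^[k] p).1 := by
  induction k with
  | zero => exact hP
  | succ k ih =>
    rw [Function.iterate_succ_apply', Function.iterate_succ_apply']
    exact V.restrictPoly_gaussDeriv X ih

theorem gauss_apply (p : V.regular) (m : V.M) :
    V.gauss p m = p.1 m * (Real.exp (-rSq m.1) : ℂ) := rfl

theorem gaussFlow_eq_π (X : V.lieAlg) {P : MvPolynomial (Fin n) ℂ} {p : V.regular}
    (hP : V.restrictPoly P = p.1) (m : V.M) (t : ℝ) :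
    gaussFlow (-X.1) P m.1 t = V.π (V.oneParam X t) (V.gauss p) m := by
  rw [gaussFlow_ofReal, π_apply, gauss_apply, ← hP, restrictPoly_apply, coe_smul,
    coe_oneParam_inv]

theorem oneParam_zero (X : V.lieAlg) : V.oneParam X 0 = 1 := by
  refine Subtype.ext (Units.ext ?_)
  change NormedSpace.exp ((0 : ℝ) • X.1) = 1
  simp

theorem norm_le_of_forall (φ : C₀(V.M, ℂ)) {C : ℝ} (hC : 0 ≤ C) (h : ∀ m, ‖φ m‖ ≤ C) :
    ‖φ‖ ≤ C :=
  (BoundedContinuousFunction.norm_le hC).2 h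

/-- Every `q · e^{-r²}` is an analytic vector, with a radius that depends on `X` only: the Taylor
series of `t ↦ π(exp(tX)) (q · e^{-r²})` converges in the sup norm, because its coefficients obey
Cauchy's estimates uniformly on `M`. -/
theorem exists_radius_hasSum_gauss (X : V.lieAlg) :
    ∃ δ : ℝ, 0 < δ ∧ ∀ (p : V.regular) (t : ℝ), |t| < δ →
      HasSum (fun k : ℕ => t ^ k • ((k.factorial : ℝ)⁻¹ • V.gauss ((V.dπ' X)^[k] p)))
        (V.π (V.oneParam X t) (V.gauss p)) := by
  obtain ⟨δ, hδ, hbound⟩ := exists_radius_gaussFlow (-X.1)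
  refine ⟨δ, hδ, fun p t ht => ?_⟩
  obtain ⟨P, hP⟩ := p.2
  replace hP : V.restrictPoly P = p.1 := hP
  obtain ⟨C, hC0, hC⟩ := hbound P
  have hcoeff : ∀ (k : ℕ) (m : V.M),
      iteratedDeriv k (gaussFlow (-X.1) P m.1) 0 = V.gauss ((V.dπ' X)^[k] p) m := by
    intro k m
    have h := V.gaussFlow_eq_π X (V.restrictPoly_gaussDeriv_iterate X hP k) m 0
    rw [oneParam_zero, map_one, Complex.ofReal_zero] at h
    rw [iteratedDeriv_gaussFlow, h]
    rfl
  have hnorm : ∀ k : ℕ, ‖V.gauss ((V.dπ' X)^[k] p)‖ ≤ k.factorial * C / δ ^ k := fun k =>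
    V.norm_le_of_forall _ (by positivity) fun m => by
      rw [← hcoeff k m]
      refine Complex.norm_iteratedDeriv_le_of_forall_mem_sphere_norm_le k hδ
        (differentiable_gaussFlow _ _ _).diffContOnCl fun z hz => hC m.1 z ?_
      rw [mem_sphere_zero_iff_norm] at hz
      exact hz.le
  have hsum : Summable fun k : ℕ =>
      t ^ k • ((k.factorial : ℝ)⁻¹ • V.gauss ((V.dπ' X)^[k] p)) := by
    refine Summable.of_norm_bounded (g := fun k => C * (|t| / δ) ^ k)
      ((summable_geometric_of_lt_one (by positivity) ((div_lt_one hδ).2 ht)).mul_left C)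
      fun k => ?_
    rw [norm_smul, norm_smul, norm_pow, Real.norm_eq_abs, norm_inv, Real.norm_natCast]
    calc _ ≤ |t| ^ k * ((k.factorial : ℝ)⁻¹ * (k.factorial * C / δ ^ k)) := by
          gcongr
          exact hnorm k
      _ = _ := by
          have : (k.factorial : ℝ) ≠ 0 := by positivity
          rw [div_pow]
          field_simp
  obtain ⟨ψ, hψ⟩ := hsum
  have hψ' : V.π (V.oneParam X t) (V.gauss p) = ψ := by
    ext m
    let ev : C₀(V.M, ℂ) →+ ℂ :=
      { toFun := fun φ => φ m, map_zero' := rfl, map_add' := fun _ _ => rfl }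
    have hev : Continuous ev :=
      (BoundedContinuousFunction.lipschitz_eval_const m).continuous.comp
        ZeroAtInftyContinuousMap.isometry_toBCF.continuous
    have h1 := hψ.map ev hev
    have h2 := Complex.hasSum_taylorSeries_of_entire
      (differentiable_gaussFlow (-X.1) P m.1) 0 (t : ℂ)
    rw [V.gaussFlow_eq_π X hP] at h2
    refine h2.unique ?_
    convert! h1 using 2 with k
    change _ = t ^ k • ((k.factorial : ℝ)⁻¹ • V.gauss ((V.dπ' X)^[k] p) m)
    rw [hcoeff]
    simp only [sub_zero, smul_eq_mul, Complex.real_smul]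
    push_cast
    ring
  rw [hψ']
  exact hψ

theorem hasDerivAt_π_gauss (X : V.lieAlg) (p : V.regular) :
    HasDerivAt (fun t : ℝ => V.π (V.oneParam X t) (V.gauss p)) (V.gauss (V.dπ' X p)) 0 := by
  obtain ⟨δ, hδ, h⟩ := V.exists_radius_hasSum_gauss X
  let c : FormalMultilinearSeries ℝ ℝ C₀(V.M, ℂ) := fun k =>
    ContinuousMultilinearMap.mkPiRing ℝ (Fin k)
      ((k.factorial : ℝ)⁻¹ • V.gauss ((V.dπ' X)^[k] p))
  have hc : ∀ k, c.coeff k = (k.factorial : ℝ)⁻¹ • V.gauss ((V.dπ' X)^[k] p) := fun k => by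
    simp [FormalMultilinearSeries.coeff, c]
  have h1 : HasFPowerSeriesAt (fun t : ℝ => V.π (V.oneParam X t) (V.gauss p)) c 0 := by
    rw [hasFPowerSeriesAt_iff]
    filter_upwards [Metric.ball_mem_nhds (0 : ℝ) hδ] with t ht
    simp_rw [hc, zero_add]
    exact h p t (by simpa using ht)
  have h2 := h1.hasDerivAt
  have h3 : (c 1 fun _ => (1 : ℝ)) = V.gauss (V.dπ' X p) := by simp [c]
  rwa [h3] at h2

theorem gauss_mem_domain (X : V.lieAlg) (p : V.regular) : V.gauss p ∈ (V.dπ X).domain :=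
  (V.hasDerivAt_π_gauss X p).differentiableAt

theorem dπ_gauss (X : V.lieAlg) (p : V.regular) :
    V.dπ X ⟨V.gauss p, V.gauss_mem_domain X p⟩ = V.gauss (V.dπ' X p) :=
  (V.hasDerivAt_π_gauss X p).deriv

end AffineGVariety

/-! ### Polar decomposition in a transpose-stable algebraic group -/

/-- If all power sums `∑ c_i x_i^k` vanish, then so does `∑ c_i φ(x_i)` for every function `φ`,
because `φ` agrees with a polynomial on the finitely many points `x_i`. -/
theorem Finset.sum_mul_eq_zero_of_sum_mul_pow {ι : Type*} (s : Finset ι) (c x : ι → ℝ)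
    (h : ∀ k : ℕ, ∑ i ∈ s, c i * x i ^ k = 0) (φ : ℝ → ℝ) : ∑ i ∈ s, c i * φ (x i) = 0 := by
  classical
  let p : Polynomial ℝ := Lagrange.interpolate (s.image x) id φ
  have hp : ∀ i ∈ s, φ (x i) = ∑ k ∈ Finset.range (p.natDegree + 1), p.coeff k * x i ^ k :=
    fun i hi => by
      rw [← Polynomial.eval_eq_sum_range]
      exact (Lagrange.eval_interpolate_at_node (v := id) φ (Set.injOn_id _)
        (Finset.mem_image_of_mem x hi)).symm
  calc ∑ i ∈ s, c i * φ (x i)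
      = ∑ k ∈ Finset.range (p.natDegree + 1), p.coeff k * ∑ i ∈ s, c i * x i ^ k := by
        simp_rw [Finset.mul_sum]
        rw [Finset.sum_comm]
        refine Finset.sum_congr rfl fun i hi => ?_
        rw [hp i hi, Finset.mul_sum]
        exact Finset.sum_congr rfl fun k _ => by ring
    _ = 0 := by simp [h]

theorem Matrix.PosDef.exists_eq_mul_diagonal_mul_transpose {n : ℕ}
    {S : Matrix (Fin n) (Fin n) ℝ} (hS : S.PosDef) :
    ∃ (U : Matrix (Fin n) (Fin n) ℝ) (d : Fin n → ℝ), U * Uᵀ = 1 ∧ (∀ i, 0 < d i) ∧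
      S = U * Matrix.diagonal d * Uᵀ := by
  refine ⟨hS.1.eigenvectorUnitary, hS.1.eigenvalues, ?_, hS.eigenvalues_pos, ?_⟩
  · have := Unitary.mul_star_self_of_mem hS.1.eigenvectorUnitary.2
    rwa [Matrix.star_eq_conjTranspose, Matrix.conjTranspose_eq_transpose_of_trivial] at this
  · have := hS.1.spectral_theorem
    rw [Unitary.conjStarAlgAut_apply, Matrix.star_eq_conjTranspose,
      Matrix.conjTranspose_eq_transpose_of_trivial] at this
    exact this

namespace AffineGVariety

variable {n : ℕ} (V : AffineGVariety n)

/-- The logarithm of a positive definite element of an algebraic group belongs to its Lie algebra: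
a polynomial in the entries of `U diag(d) Uᵀ` that vanishes at all powers of this matrix is a
linear combination of monomials in the `dᵢ` to which `Finset.sum_mul_eq_zero_of_sum_mul_pow`
applies. (In the conclusion the logarithm is multiplied by `1 / 2`.) -/
theorem mul_diagonal_log_mem_lieAlg {s : GL (Fin n) ℝ} (hs : s ∈ V.G)
    {U : Matrix (Fin n) (Fin n) ℝ} {d : Fin n → ℝ} (hU : U * Uᵀ = 1) (hd : ∀ i, 0 < d i)
    (h : (s : Matrix (Fin n) (Fin n) ℝ) = U * Matrix.diagonal d * Uᵀ) :
    U * Matrix.diagonal (fun i => Real.log (d i) / 2) * Uᵀ ∈ V.lieAlg := by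
  intro t
  have hUt : Uᵀ * U = 1 := mul_eq_one_comm.1 hU
  have hUinv : U⁻¹ = Uᵀ := Matrix.inv_eq_right_inv hU
  obtain ⟨T, hT⟩ := V.algebraic_G
  refine (hT _).2 fun f hf => ?_
  let F : MvPolynomial (Fin n) ℝ := MvPolynomial.bind₁ (fun ij : Fin n × Fin n =>
    ∑ l, MvPolynomial.C (U ij.1 l) * MvPolynomial.X l * MvPolynomial.C (U ij.2 l)) f
  have hF : ∀ y : Fin n → ℝ, MvPolynomial.eval y F
      = MvPolynomial.eval (fun ij => (U * Matrix.diagonal y * Uᵀ) ij.1 ij.2) f := fun y => by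
    simp only [F]
    rw [MvPolynomial.eval, MvPolynomial.eval₂Hom_bind₁]
    congr 2
    funext ij
    rw [Matrix.mul_apply]
    simp [Matrix.mul_diagonal]
  have hpow : ∀ k : ℕ, ((s ^ k : GL (Fin n) ℝ) : Matrix (Fin n) (Fin n) ℝ)
      = U * Matrix.diagonal (fun i => d i ^ k) * Uᵀ := by
    intro k
    induction k with
    | zero => simp [hU]
    | succ k ih =>
      rw [pow_succ, Units.val_mul, ih, h]
      calc _ = U * Matrix.diagonal (fun i => d i ^ k) * (Uᵀ * U) * Matrix.diagonal d * Uᵀ := by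
            simp only [Matrix.mul_assoc]
        _ = _ := by
            rw [hUt, Matrix.mul_one, Matrix.mul_assoc U, Matrix.diagonal_mul_diagonal]
            simp only [pow_succ]
  have hzero : ∀ k : ℕ, ∑ α ∈ F.support, F.coeff α * (∏ i, d i ^ α i) ^ k = 0 := fun k => by
    have h1 := (hT _).1 (V.G.pow_mem hs k) f hf
    rw [hpow, ← hF, MvPolynomial.eval_eq'] at h1
    rw [← h1]
    refine Finset.sum_congr rfl fun α _ => ?_
    rw [← Finset.prod_pow]
    congr 1
    exact Finset.prod_congr rfl fun i _ => pow_right_comm _ _ _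
  have hexp : ((expGL (t • (U * Matrix.diagonal (fun i => Real.log (d i) / 2) * Uᵀ)) :
      GL (Fin n) ℝ) : Matrix (Fin n) (Fin n) ℝ)
      = U * Matrix.diagonal (fun i => Real.exp (t / 2 * Real.log (d i))) * Uᵀ := by
    change NormedSpace.exp _ = _
    rw [← Matrix.smul_mul, ← Matrix.mul_smul, ← hUinv,
      Matrix.exp_conj _ _ (IsUnit.of_mul_eq_one _ hU), ← Matrix.diagonal_smul,
      Matrix.exp_diagonal]
    congr 3
    funext i
    rw [Pi.coe_exp, ← Real.exp_eq_exp_ℝ]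
    simp only [Pi.smul_apply, smul_eq_mul]
    ring_nf
  rw [hexp, ← hF, MvPolynomial.eval_eq',
    ← F.support.sum_mul_eq_zero_of_sum_mul_pow _ _ hzero
      fun x => Real.exp (t / 2 * Real.log x)]
  refine Finset.sum_congr rfl fun α _ => ?_
  congr 1
  rw [Real.log_prod fun i _ => (pow_pos (hd i) _).ne', Finset.mul_sum, Real.exp_sum]
  refine Finset.prod_congr rfl fun i _ => ?_
  rw [← Real.exp_nat_mul, Real.log_pow]
  ring_nf

/-- The polar decomposition `g = k exp(Y)`, where `k` is orthogonal. -/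
theorem exists_polar_decomposition (hG : V.TransposeStable) (g : V.G) :
    ∃ (k : V.G) (Y : V.lieAlg), (k.1 : Matrix (Fin n) (Fin n) ℝ)ᵀ * k.1.1 = 1 ∧
      g = k * V.oneParam Y 1 := by
  obtain ⟨h, hh, hgh⟩ := hG g.1 g.2
  have hpos : ((h * g.1 : GL (Fin n) ℝ) : Matrix (Fin n) (Fin n) ℝ).PosDef := by
    rw [Units.val_mul, hgh, ← Matrix.conjTranspose_eq_transpose_of_trivial]
    exact Matrix.PosDef.conjTranspose_mul_self _
      (Matrix.mulVec_injective_of_isUnit g.1.isUnit)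
  obtain ⟨U, d, hU, hd, hUd⟩ := hpos.exists_eq_mul_diagonal_mul_transpose
  have hUt : Uᵀ * U = 1 := mul_eq_one_comm.1 hU
  have hUinv : U⁻¹ = Uᵀ := Matrix.inv_eq_right_inv hU
  let Y : V.lieAlg := ⟨_, V.mul_diagonal_log_mem_lieAlg (V.G.mul_mem hh g.2) hU hd hUd⟩
  have hY : ((V.oneParam Y 1).1 : Matrix (Fin n) (Fin n) ℝ)
      = U * Matrix.diagonal (fun i => Real.exp (Real.log (d i) / 2)) * Uᵀ := by
    change NormedSpace.exp ((1 : ℝ) • (U * Matrix.diagonal _ * Uᵀ)) = _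
    rw [one_smul, ← hUinv, Matrix.exp_conj _ _ (IsUnit.of_mul_eq_one _ hU),
      Matrix.exp_diagonal]
    congr 3
    funext i
    rw [Pi.coe_exp, ← Real.exp_eq_exp_ℝ]
  set E : Matrix (Fin n) (Fin n) ℝ := ((V.oneParam Y 1).1 : Matrix (Fin n) (Fin n) ℝ) with hE
  have hEt : Eᵀ = E := by
    rw [hY]
    simp [Matrix.mul_assoc]
  have hEE : E * E = (g.1 : Matrix (Fin n) (Fin n) ℝ)ᵀ * g.1.1 := by
    rw [← hgh, ← Units.val_mul h, hUd, hY]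
    calc _ = U * Matrix.diagonal (fun i => Real.exp (Real.log (d i) / 2)) * (Uᵀ * U)
          * Matrix.diagonal (fun i => Real.exp (Real.log (d i) / 2)) * Uᵀ := by
          simp only [Matrix.mul_assoc]
      _ = _ := by
          rw [hUt, Matrix.mul_one, Matrix.mul_assoc U, Matrix.diagonal_mul_diagonal]
          congr 3
          funext i
          rw [← Real.exp_add, add_halves, Real.exp_log (hd i)]
  refine ⟨g * (V.oneParam Y 1)⁻¹, Y, ?_, by group⟩
  have hdet : IsUnit E.det := (Matrix.isUnit_iff_isUnit_det _).1 (V.oneParam Y 1).1.isUnit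
  have hk : ((g * (V.oneParam Y 1)⁻¹ : V.G).1 : Matrix (Fin n) (Fin n) ℝ) = g.1.1 * E⁻¹ := by
    rw [Subgroup.coe_mul, Subgroup.coe_inv, Units.val_mul, Matrix.coe_units_inv]
  rw [hk, Matrix.transpose_mul, Matrix.transpose_nonsing_inv, hEt]
  calc _ = E⁻¹ * ((g.1 : Matrix (Fin n) (Fin n) ℝ)ᵀ * g.1.1) * E⁻¹ := by
        simp only [Matrix.mul_assoc]
    _ = 1 := by
        rw [← hEE, ← Matrix.mul_assoc, Matrix.nonsing_inv_mul _ hdet, Matrix.one_mul,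
          Matrix.mul_nonsing_inv _ hdet]

/-- The subgroup `G ∩ O(n)`. -/
def orthogonalPart : Subgroup V.G where
  carrier := {g | (g.1 : Matrix (Fin n) (Fin n) ℝ)ᵀ * g.1.1 = 1}
  one_mem' := by simp
  mul_mem' := fun {a b} ha hb => by
    simp only [Set.mem_ofPred_eq, Subgroup.coe_mul, Units.val_mul, Matrix.transpose_mul] at *
    calc _ = (b.1.1)ᵀ * ((a.1.1)ᵀ * a.1.1) * b.1.1 := by simp only [Matrix.mul_assoc]
      _ = 1 := by rw [ha, Matrix.mul_one, hb]
  inv_mem' := fun {a} ha => by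
    simp only [Set.mem_ofPred_eq, Subgroup.coe_inv] at *
    rw [Matrix.coe_units_inv, Matrix.inv_eq_left_inv ha, Matrix.transpose_transpose]
    exact mul_eq_one_comm.1 ha

theorem isCompact_orthogonalPart : IsCompact (V.orthogonalPart : Set V.G) := by
  obtain ⟨T, hT⟩ := V.algebraic_G
  -- `G ∩ O(n)` as a closed and bounded set of matrices
  let Z : Set (Matrix (Fin n) (Fin n) ℝ) :=
    {A | Aᵀ * A = 1 ∧ ∀ f ∈ T, MvPolynomial.eval (fun ij => A ij.1 ij.2) f = 0}
  have hZ : IsCompact Z := by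
    refine (isCompact_Icc (a := (-1 : ℝ)) (b := 1)).matrix.of_isClosed_subset ?_ ?_
    · have hcl : IsClosed {A : Matrix (Fin n) (Fin n) ℝ |
          ∀ f ∈ T, MvPolynomial.eval (fun ij => A ij.1 ij.2) f = 0} := by
        simp only [Set.ofPred_forall]
        refine isClosed_biInter fun f _ => isClosed_eq
          ((MvPolynomial.continuous_eval f).comp ?_) continuous_const
        exact continuous_pi fun ij => continuous_apply_apply ij.1 ij.2
      exact (isClosed_eq (by fun_prop) continuous_const).inter hcl
    · rintro A ⟨hA, -⟩ i j
      have h1 : ∑ k, A k j * A k j = 1 := by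
        have := congrFun (congrFun hA j) j
        simpa [Matrix.mul_apply] using this
      have h2 : A i j * A i j ≤ 1 := h1 ▸ Finset.single_le_sum
        (f := fun k => A k j * A k j) (fun k _ => mul_self_nonneg _) (Finset.mem_univ i)
      exact abs_le.1 ((sq_le_one_iff_abs_le_one _).1 (by rwa [sq]))
  have : CompactSpace Z := isCompact_iff_compactSpace.1 hZ
  let u : Z → GL (Fin n) ℝ := fun A => ⟨A.1, A.1ᵀ, mul_eq_one_comm.1 A.2.1, A.2.1⟩
  have hu : Continuous u := Units.continuous_iff.2
    ⟨continuous_subtype_val, continuous_subtype_val.matrix_transpose⟩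
  let v : Z → V.G := fun A => ⟨u A, (hT _).2 A.2.2⟩
  have hv : Continuous v := hu.subtype_mk _
  convert isCompact_range hv
  ext g
  constructor
  · intro hg
    exact ⟨⟨g.1.1, hg, (hT g.1).1 g.2⟩, Subtype.ext (Units.ext rfl)⟩
  · rintro ⟨A, rfl⟩
    exact A.2.1

theorem mem_orthogonalPart_of_rSq {k : V.G}
    (hk : ∀ m : Fin n → ℝ, rSq ((k.1 : Matrix (Fin n) (Fin n) ℝ) *ᵥ m) = rSq m) :
    k ∈ V.orthogonalPart := by
  set A : Matrix (Fin n) (Fin n) ℝ := (k.1 : Matrix (Fin n) (Fin n) ℝ) with hA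
  have hr : ∀ m : Fin n → ℝ, rSq m = m ⬝ᵥ m := fun m => by simp [rSq, dotProduct, sq]
  have hpol : ∀ x y : Fin n → ℝ, (A *ᵥ x) ⬝ᵥ (A *ᵥ y) = x ⬝ᵥ y := fun x y => by
    have h1 := hk (x + y)
    have hx := hk x
    have hy := hk y
    simp only [hr, Matrix.mulVec_add, add_dotProduct, dotProduct_add] at h1 hx hy
    rw [dotProduct_comm (A *ᵥ y), dotProduct_comm y] at h1
    linarith
  change Aᵀ * A = 1
  ext i j
  have h := hpol (Pi.single i 1) (Pi.single j 1)
  simpa [Matrix.mul_apply, dotProduct, Matrix.one_apply, Pi.single_apply, eq_comm] using h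

/-- A maximal compact subgroup that preserves `r²` is the whole of `G ∩ O(n)`. -/
theorem IsMaximalCompact.eq_orthogonalPart {V : AffineGVariety n} {K : Subgroup V.G}
    (hK : V.IsMaximalCompact K) (hKr : ∀ k ∈ K, ∀ m : Fin n → ℝ,
      rSq ((k.1 : Matrix (Fin n) (Fin n) ℝ) *ᵥ m) = rSq m) : K = V.orthogonalPart :=
  have hle : K ≤ V.orthogonalPart := fun k hk => V.mem_orthogonalPart_of_rSq (hKr k hk)
  le_antisymm hle (hK.2 V.isCompact_orthogonalPart hle)

end AffineGVariety

/-! ### Continuity of the regular representation -/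

namespace AffineGVariety

variable {n : ℕ} (V : AffineGVariety n)

instance : ContinuousSMul V.G V.M where
  continuous_smul := by
    refine Continuous.subtype_mk ?_ _
    exact (Units.continuous_val.comp (continuous_subtype_val.comp continuous_fst)).matrix_mulVec
      (continuous_subtype_val.comp continuous_snd)

theorem norm_π_apply_le (g : V.G) (φ : C₀(V.M, ℂ)) : ‖V.π g φ‖ ≤ ‖φ‖ :=
  V.norm_le_of_forall _ (norm_nonneg φ) fun m =>
    BoundedContinuousFunction.norm_coe_le_norm φ.toBCF (g⁻¹ • m)

theorem tendsto_π_one (φ : C₀(V.M, ℂ)) :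
    Filter.Tendsto (fun g => V.π g φ) (nhds 1) (nhds φ) := by
  rw [Metric.tendsto_nhds]
  intro ε hε
  -- off the compact set `Q` the function is small
  obtain ⟨Q, hQ, hφQ⟩ : ∃ Q : Set V.M, IsCompact Q ∧ ∀ m ∉ Q, ‖φ m‖ < ε / 4 := by
    have h := (Metric.tendsto_nhds.1 (zero_at_infty φ)) (ε / 4) (by positivity)
    obtain ⟨Q, hQ, hsub⟩ := Filter.mem_cocompact.1 h
    exact ⟨Q, hQ, fun m hm => by simpa using hsub hm⟩
  have h1 : ∀ᶠ g : V.G in nhds 1, ∀ m ∈ Q, ‖φ (g • m) - φ m‖ < ε / 2 := by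
    refine hQ.eventually_forall_of_forall_eventually fun m _ => ?_
    have hc : Continuous fun z : V.G × V.M => ‖φ (z.1 • z.2) - φ z.2‖ :=
      ((φ.continuous.comp continuous_smul).sub (φ.continuous.comp continuous_snd)).norm
    exact hc.continuousAt.eventually_lt continuousAt_const (by simpa using half_pos hε)
  have h2 : ∀ᶠ g : V.G in nhds 1, ∀ m ∈ Q, ‖φ (g⁻¹ • m) - φ m‖ < ε / 2 :=
    (continuous_inv.tendsto' (1 : V.G) 1 inv_one).eventually h1
  filter_upwards [h1, h2] with g hg1 hg2
  rw [dist_eq_norm]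
  refine (V.norm_le_of_forall _ (half_pos hε).le fun m => ?_).trans_lt (half_lt_self hε)
  change ‖φ (g⁻¹ • m) - φ m‖ ≤ ε / 2
  by_cases hm : m ∈ Q
  · exact (hg2 m hm).le
  by_cases hm' : g⁻¹ • m ∈ Q
  · have h := hg1 _ hm'
    rw [smul_inv_smul, norm_sub_rev] at h
    exact h.le
  · have ha := hφQ m hm
    have hb := hφQ _ hm'
    have hab := norm_sub_le (φ (g⁻¹ • m)) (φ m)
    linarith

theorem continuous_π (φ : C₀(V.M, ℂ)) : Continuous fun g => V.π g φ := by
  refine continuous_iff_continuousAt.2 fun g => ?_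
  have h1 : Filter.Tendsto (fun h : V.G => g⁻¹ * h) (nhds g) (nhds 1) :=
    (continuous_const_mul g⁻¹).tendsto' g 1 (inv_mul_cancel g)
  have h2 := ((V.π g).continuous.tendsto φ).comp ((V.tendsto_π_one φ).comp h1)
  refine h2.congr fun h => ?_
  change (V.π g * V.π (g⁻¹ * h)) φ = _
  rw [← map_mul, mul_inv_cancel_left]

/-! ### Invariance of the spaces `W_p` under `K` -/

section W

variable {V} {K : Subgroup V.G} {p : V.regular}

theorem π_gauss_mem_W {k : V.G} (hk : k ∈ K) : V.π k (V.gauss p) ∈ V.W K p :=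
  Submodule.mem_sInf.2 fun _ hS => hS.1 k hk

theorem gauss_mem_W : V.gauss p ∈ V.W K p := by
  simpa using π_gauss_mem_W (p := p) K.one_mem

theorem dπ_mem_W (X : V.lieAlg) (φ : (V.dπ X).domain) (hφ : (φ : C₀(V.M, ℂ)) ∈ V.W K p) :
    V.dπ X φ ∈ V.W K p :=
  Submodule.mem_sInf.2 fun S hS => hS.2 X φ (Submodule.mem_sInf.1 hφ S hS)

theorem W_le {S : Submodule ℂ C₀(V.M, ℂ)} (h1 : ∀ k ∈ K, V.π k (V.gauss p) ∈ S)
    (h2 : ∀ (X : V.lieAlg) (φ : (V.dπ X).domain), (φ : C₀(V.M, ℂ)) ∈ S → V.dπ X φ ∈ S) :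
    V.W K p ≤ S :=
  sInf_le ⟨h1, h2⟩

theorem gauss_dπ'_mem_W (X : V.lieAlg) {q : V.regular} (hq : V.gauss q ∈ V.W K p) :
    V.gauss (V.dπ' X q) ∈ V.W K p :=
  V.dπ_gauss X q ▸ dπ_mem_W X ⟨_, V.gauss_mem_domain X q⟩ hq

theorem expGL_conj (g : GL (Fin n) ℝ) (A : Matrix (Fin n) (Fin n) ℝ) (t : ℝ) :
    expGL (t • ((g : Matrix (Fin n) (Fin n) ℝ) * A * ((g⁻¹ : GL (Fin n) ℝ) : Matrix _ _ ℝ)))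
      = g * expGL (t • A) * g⁻¹ := by
  refine Units.ext ?_
  change NormedSpace.exp _ = (g : Matrix (Fin n) (Fin n) ℝ) * NormedSpace.exp (t • A) * _
  rw [← Matrix.exp_units_conj, Matrix.mul_smul, Matrix.smul_mul]

/-- The adjoint action `X ↦ g X g⁻¹` of `G` on its Lie algebra. -/
def Ad (g : V.G) (X : V.lieAlg) : V.lieAlg :=
  ⟨(g.1 : Matrix (Fin n) (Fin n) ℝ) * X.1 * ((g.1⁻¹ : GL (Fin n) ℝ) : Matrix _ _ ℝ), fun t => by
    rw [expGL_conj]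
    exact V.G.mul_mem (V.G.mul_mem g.2 (X.2 t)) (V.G.inv_mem g.2)⟩

theorem oneParam_Ad (g : V.G) (X : V.lieAlg) (t : ℝ) :
    V.oneParam (Ad g X) t = g * V.oneParam X t * g⁻¹ :=
  Subtype.ext (expGL_conj g.1 X.1 t)

theorem hasDerivAt_π_Ad (g : V.G) (X : V.lieAlg) (φ : (V.dπ X).domain) :
    HasDerivAt (fun t : ℝ => V.π (V.oneParam (Ad g X) t) (V.π g φ)) (V.π g (V.dπ X φ)) 0 := by
  have h : HasDerivAt (fun t : ℝ => V.π (V.oneParam X t) (φ : C₀(V.M, ℂ))) (V.dπ X φ) 0 :=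
    DifferentiableAt.hasDerivAt φ.2
  have h2 := ((V.π g).restrictScalars ℝ).hasFDerivAt.comp_hasDerivAt 0 h
  refine h2.congr_of_eventuallyEq (Filter.Eventually.of_forall fun t => ?_)
  change (V.π (V.oneParam (Ad g X) t) * V.π g) φ = (V.π g * V.π (V.oneParam X t)) φ
  rw [← map_mul, ← map_mul, oneParam_Ad, inv_mul_cancel_right]

/-- `W_p` is `K`-invariant, since `π(k) dπ(X) = dπ(Ad(k) X) π(k)`. -/
theorem π_mem_W {k : V.G} (hk : k ∈ K) {φ : C₀(V.M, ℂ)} (hφ : φ ∈ V.W K p) :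
    V.π k φ ∈ V.W K p := by
  let S : Submodule ℂ C₀(V.M, ℂ) := (V.W K p).comap (V.π k).toLinearMap
  refine (W_le (S := S) (fun l hl => ?_) fun X ψ hψ => ?_) hφ
  · change (V.π k * V.π l) (V.gauss p) ∈ V.W K p
    rw [← map_mul]
    exact π_gauss_mem_W (K.mul_mem hk hl)
  · have h := hasDerivAt_π_Ad k X ψ
    change V.π k (V.dπ X ψ) ∈ V.W K p
    have h2 := dπ_mem_W (Ad k X) ⟨V.π k ψ, h.differentiableAt⟩ hψ
    have h3 : V.dπ (Ad k X) ⟨V.π k ψ, h.differentiableAt⟩ = V.π k (V.dπ X ψ) := h.deriv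
    rwa [h3] at h2

theorem W_dπ'_le (X : V.lieAlg) : V.W K (V.dπ' X p) ≤ V.W K p :=
  W_le (fun _ hk => π_mem_W hk (gauss_dπ'_mem_W X gauss_mem_W)) dπ_mem_W

/-! ### Invariance of the closures of the spaces `W_p` under `G` -/

variable (V) in
/-- The space `ℂ[M] · e^{-r²}`. -/
def gaussSpace : Submodule ℂ C₀(V.M, ℂ) where
  carrier := Set.range V.gauss
  add_mem' := by
    rintro _ _ ⟨p, rfl⟩ ⟨q, rfl⟩
    refine ⟨p + q, ?_⟩
    ext m
    exact add_mul (p.1 m) (q.1 m) _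
  zero_mem' := ⟨0, by
    ext m
    exact zero_mul _⟩
  smul_mem' := by
    rintro c _ ⟨p, rfl⟩
    refine ⟨c • p, ?_⟩
    ext m
    exact mul_assoc c (p.1 m) _

theorem comp_smul_mem_regular (g : V.G) (p : V.regular) :
    (fun m => p.1 (g • m)) ∈ V.regular := by
  obtain ⟨P, hP⟩ := p.2
  replace hP : V.restrictPoly P = p.1 := hP
  refine ⟨MvPolynomial.bind₁ (fun i => ∑ j, MvPolynomial.C
    (((g.1 : Matrix (Fin n) (Fin n) ℝ) i j : ℝ) : ℂ) * MvPolynomial.X j) P, ?_⟩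
  funext m
  change V.restrictPoly _ m = _
  rw [← hP, restrictPoly_apply, restrictPoly_apply, coe_smul, MvPolynomial.eval,
    MvPolynomial.eval₂Hom_bind₁]
  congr 2
  funext i
  simp [Matrix.mulVec, dotProduct]

theorem W_le_gaussSpace (hKr : ∀ k ∈ K, ∀ m : Fin n → ℝ,
      rSq ((k.1 : Matrix (Fin n) (Fin n) ℝ) *ᵥ m) = rSq m) : V.W K p ≤ V.gaussSpace := by
  refine W_le (fun k hk => ⟨⟨_, comp_smul_mem_regular k⁻¹ p⟩, ?_⟩) ?_
  · ext m
    rw [π_apply, gauss_apply, gauss_apply, coe_smul, hKr k⁻¹ (K.inv_mem hk)]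
  · rintro X ⟨_, hφ⟩ ⟨q, rfl⟩
    exact ⟨V.dπ' X q, (V.dπ_gauss X q).symm⟩

theorem oneParam_natCast_mul (X : V.lieAlg) (N : ℕ) (t : ℝ) :
    V.oneParam X (N * t) = V.oneParam X t ^ N := by
  refine Subtype.ext (Units.ext ?_)
  rw [Subgroup.coe_pow, Units.val_pow_eq_pow_val]
  change NormedSpace.exp ((N * t) • X.1) = NormedSpace.exp (t • X.1) ^ N
  rw [← Matrix.exp_nsmul, mul_smul, Nat.cast_smul_eq_nsmul]

/-- The closure of `W_p` is invariant under one-parameter groups: for small times by the Taylor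
expansion of analytic vectors, hence for all times. -/
theorem π_oneParam_mem_closure_W (hKr : ∀ k ∈ K, ∀ m : Fin n → ℝ,
      rSq ((k.1 : Matrix (Fin n) (Fin n) ℝ) *ᵥ m) = rSq m) (X : V.lieAlg) (t : ℝ)
    {φ : C₀(V.M, ℂ)} (hφ : φ ∈ (V.W K p).topologicalClosure) :
    V.π (V.oneParam X t) φ ∈ (V.W K p).topologicalClosure := by
  obtain ⟨δ, hδ, hsum⟩ := V.exists_radius_hasSum_gauss X
  let St : Submonoid V.G :=
    { carrier := {g | ∀ φ ∈ (V.W K p).topologicalClosure,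
        V.π g φ ∈ (V.W K p).topologicalClosure}
      one_mem' := fun φ hφ => by simpa using hφ
      mul_mem' := fun {a b} ha hb φ hφ => by
        rw [map_mul]
        exact ha _ (hb φ hφ) }
  have hsmall : ∀ s : ℝ, |s| < δ → V.oneParam X s ∈ St := by
    intro s hs ψ hψ
    have hmaps : Set.MapsTo (V.π (V.oneParam X s)) (V.W K p)
        ((V.W K p).topologicalClosure : Set C₀(V.M, ℂ)) := by
      intro χ hχ
      obtain ⟨q, rfl⟩ := W_le_gaussSpace hKr hχ
      have hmem : ∀ k : ℕ, V.gauss ((V.dπ' X)^[k] q) ∈ V.W K p := fun k => by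
        induction k with
        | zero => exact hχ
        | succ k ih =>
          rw [Function.iterate_succ_apply']
          exact gauss_dπ'_mem_W X ih
      refine (V.W K p).isClosed_topologicalClosure.mem_of_tendsto
        (hsum q s hs).tendsto_sum_nat (Filter.Eventually.of_forall fun N => ?_)
      refine (V.W K p).le_topologicalClosure (Submodule.sum_mem _ fun k _ => ?_)
      exact Submodule.smul_of_tower_mem _ _ (Submodule.smul_of_tower_mem _ _ (hmem k))
    have h := map_mem_closure (V.π (V.oneParam X s)).continuous hψ hmaps
    rwa [(V.W K p).isClosed_topologicalClosure.closure_eq] at h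
  obtain ⟨N, hN⟩ := exists_nat_gt (|t| / δ)
  have hN0 : 0 < (N : ℝ) := (by positivity : 0 ≤ |t| / δ).trans_lt hN
  have ht : V.oneParam X t = V.oneParam X (t / N) ^ N := by
    rw [← oneParam_natCast_mul, mul_div_cancel₀ _ hN0.ne']
  have hmem : V.oneParam X t ∈ St := by
    rw [ht]
    refine St.pow_mem (hsmall _ ?_) N
    rw [abs_div, Nat.abs_cast, div_lt_iff₀ hN0]
    rwa [div_lt_iff₀ hδ, mul_comm] at hN
  exact hmem φ hφ

theorem π_mem_closure_W (hG : V.TransposeStable) (hK : V.IsMaximalCompact K)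
    (hKr : ∀ k ∈ K, ∀ m : Fin n → ℝ,
      rSq ((k.1 : Matrix (Fin n) (Fin n) ℝ) *ᵥ m) = rSq m) (g : V.G)
    {φ : C₀(V.M, ℂ)} (hφ : φ ∈ (V.W K p).topologicalClosure) :
    V.π g φ ∈ (V.W K p).topologicalClosure := by
  obtain ⟨k, Y, hk, rfl⟩ := V.exists_polar_decomposition hG g
  have hkK : k ∈ K := by
    rw [hK.eq_orthogonalPart hKr]
    exact hk
  rw [map_mul]
  change V.π k (V.π _ φ) ∈ closure (V.W K p : Set C₀(V.M, ℂ))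
  exact map_mem_closure (V.π k).continuous (π_oneParam_mem_closure_W hKr Y 1 hφ)
    fun χ hχ => π_mem_W hkK hχ

end W

end AffineGVariety

end

/-! ### The reducing series -/

theorem mainTheorem5 {n : ℕ} (V : AffineGVariety n) (hG : V.TransposeStable)
    [MeasurableSpace V.G] [BorelSpace V.G]
    (ν : MeasureTheory.Measure V.G) [ν.IsHaarMeasure]
    (K : Subgroup V.G) (hK : V.IsMaximalCompact K)
    (hKr : ∀ k ∈ K, ∀ m : Fin n → ℝ,
      rSq ((k.1 : Matrix (Fin n) (Fin n) ℝ) *ᵥ m) = rSq m)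
    (p : V.regular) (X : ℕ → V.lieAlg)
    (B : ℕ → Submodule ℂ C₀(V.M, ℂ))
    (hB : ∀ k, B k = (V.W K (V.iter X p k)).topologicalClosure) :
    Antitone B ∧
    ∃ hinv : ∀ g, ∀ φ ∈ B 0, V.π g φ ∈ B 0,
      IsBanachRep (restrictRep V.π (B 0) hinv) ∧
      (∀ N : ℕ, IsDiscreteReducingSeries ν (restrictRep V.π (B 0) hinv)
        ({A | ∃ k ≤ N, A = (B k).submoduleOf (B 0)} ∪ {⊥})) ∧
      IsDiscreteReducingSeries ν (restrictRep V.π (B 0) hinv)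
        ({A | ∃ k, A = (B k).submoduleOf (B 0)} ∪ {(⨅ k, B k).submoduleOf (B 0), ⊥}) := by
  have hanti : Antitone B := antitone_nat_of_succ_le fun k => by
    rw [hB, hB]
    exact Submodule.topologicalClosure_mono (AffineGVariety.W_dπ'_le (X k))
  have hclosed : ∀ k, IsClosed (B k : Set C₀(V.M, ℂ)) := fun k => by
    rw [hB]
    exact Submodule.isClosed_topologicalClosure _
  have hinv : ∀ k g, ∀ φ ∈ B k, V.π g φ ∈ B k := fun k g φ hφ => by
    rw [hB] at hφ ⊢
    exact AffineGVariety.π_mem_closure_W hG hK hKr g hφ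
  have hcomplete : CompleteSpace (B 0) := (hclosed 0).completeSpace_coe
  let C : ℕ → Submodule ℂ (B 0) := fun k => (B k).submoduleOf (B 0)
  have hC : Antitone C := fun i j hij => Submodule.comap_mono (hanti hij)
  have hC0 : C 0 = ⊤ := Submodule.submoduleOf_self _
  have hCcl : ∀ k, IsClosed (C k : Set (B 0)) := fun k =>
    (hclosed k).preimage continuous_subtype_val
  have hCinv : ∀ k g, ∀ φ ∈ C k, restrictRep V.π (B 0) (hinv 0) g φ ∈ C k :=
    fun k g φ hφ => hinv k g φ hφ
  refine ⟨hanti, hinv 0, ⟨hcomplete, fun φ => (V.continuous_π φ).subtype_mk _⟩,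
    hC.isDiscreteReducingSeries_finite ν _ hC0 hCcl hCinv, ?_⟩
  have h := hC.isDiscreteReducingSeries ν (restrictRep V.π (B 0) (hinv 0)) hC0 hCcl hCinv
  have hinf : (⨅ k, B k).submoduleOf (B 0) = ⨅ k, C k := Submodule.comap_iInf _ _
  have hrange : {A | ∃ k, A = (B k).submoduleOf (B 0)} = Set.range C :=
    Set.ext fun A => exists_congr fun k => eq_comm
  rwa [hinf, hrange]
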